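/- Let $X$ be a finite set and $d\ge 2$. A point configuration in $\mathbb{R}^d$ labeled by $X$ is a map $P=(p_i)_{i\in X}\in(\mathbb{R}^d)^X$; it is full-dimensional if its affine hull is $\mathbb{R}^d$. Its chirotope $\chi_P: X^{d+1}\to\{-,0,+\}$ is \[\chi_P(i_1,\dots,i_{d+1})=\operatorname{sign}\det\begin{pmatrix}p_{i_1}&\cdots&p_{i_{d+1}}\\1&\cdots&1\end{pmatrix}.\] For a finite set $Y\supseteq X$, a configuration $\widehat P\in(\mathbb{R}^d)^Y$ extends $P$ if $\widehat p_i=p_i$ for all $i\in X$. The extension is generic if for every $y\in Y\setminus X$ the point $\widehat p_y$ lies on no hyperplane spanned by points of $\widehat P$ with labels in $Y\setminus\{y\}$. A function $\chi:Y^{d+1}\to\{-,0,+\}$ is realizable on top of $Q\in(\mathbb{R}^d)^X$ if some extension of $Q$ labeled by $Y$ has chirotope $\chi$. A direct affine transform of $\mathbb{R}^d$ is an invertible affine map whose linear part has positive determinant. **Theorem.** For every $d\ge 2$ and every full-dimensional point configuration $P=(p_i)_{i\in X}\in(\mathbb{R}^d)^X$ there exist constants $C(P)$ and $\tau(P)>0$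 such that for every $0<\varepsilon\le\tau(P)$ there exists a finite generic extension $\widehat P$ of $P$, with at most $C(P)\log\frac1\varepsilon$ new points, with the following property: for every configuration $Q=(q_i)_{i\in X}\in(\mathbb{R}^d)^X$ such that $\chi_{\widehat P}$ is realizable on top of $Q$, there exists a direct affine transform $\varphi$ of $\mathbb{R}^d$ such that $\max_{i\in X}\|p_i-\varphi(q_i)\|_2\le\varepsilon$. -/

import Mathlib

/-- A point configuration in `ℝ^d` with label set `X`; all label sets used below are finite. -/
abbrev PointConfig (d : ℕ) (X : Type*) : Type _ := X → EuclideanSpace ℝ (Fin d)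

/-- The orientation of a `(d+1)`-tuple of points of `ℝ^d`: the sign of the determinant of the
matrix whose column `j` consists of the coordinates of the `j`-th point followed by `1`. -/
noncomputable def orientationSign {d : ℕ} (p : Fin (d + 1) → EuclideanSpace ℝ (Fin d)) :
    SignType :=
  SignType.sign
    (Matrix.det (Matrix.of fun i j : Fin (d + 1) =>
      (Fin.snoc (fun k : Fin d => p j k) 1 : Fin (d + 1) → ℝ) i))

/-- The chirotope of a point configuration. -/
noncomputable def chirotope {d : ℕ} {X : Type*} (P : PointConfig d X) :
    (Fin (d + 1) → X) → SignType :=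
  fun t => orientationSign fun j => P (t j)

/-- The affine hull of the configuration is the whole space. -/
def IsFullDimensional {d : ℕ} {X : Type*} (P : PointConfig d X) : Prop :=
  affineSpan ℝ (Set.range P) = ⊤

/-- `Phat`, labeled by the disjoint union of `X` and a set `Y` of new labels, extends `P`. -/
def Extends {d : ℕ} {X Y : Type*} (Phat : PointConfig d (X ⊕ Y)) (P : PointConfig d X) : Prop :=
  ∀ i : X, Phat (Sum.inl i) = P i

/-- A hyperplane: a nonempty affine subspace of dimension `d - 1`. -/
def IsHyperplane {d : ℕ} (H : AffineSubspace ℝ (EuclideanSpace ℝ (Fin d))) : Prop :=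
  (H : Set (EuclideanSpace ℝ (Fin d))).Nonempty ∧ Module.finrank ℝ H.direction + 1 = d

/-- `Phat` extends `P`, and no new point lies on a hyperplane spanned by other points
(points with other labels) of `Phat`. -/
def IsGenericExtension {d : ℕ} {X Y : Type*} (Phat : PointConfig d (X ⊕ Y))
    (P : PointConfig d X) : Prop :=
  Extends Phat P ∧
    ∀ (y : Y) (S : Set (X ⊕ Y)), Sum.inr y ∉ S →
      IsHyperplane (affineSpan ℝ (Phat '' S)) →
      Phat (Sum.inr y) ∉ affineSpan ℝ (Phat '' S)

/-- The sign function `χ` on `X ⊕ Y` is the chirotope of some extension of `Q`. -/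
def IsRealizableOnTop {d : ℕ} {X Y : Type*} (χ : (Fin (d + 1) → X ⊕ Y) → SignType)
    (Q : PointConfig d X) : Prop :=
  ∃ Qhat : PointConfig d (X ⊕ Y), Extends Qhat Q ∧ chirotope Qhat = χ

/-- A direct (orientation-preserving) invertible affine transformation of `ℝ^d`. -/
def IsDirect {d : ℕ} (φ : EuclideanSpace ℝ (Fin d) ≃ᵃ[ℝ] EuclideanSpace ℝ (Fin d)) : Prop :=
  0 < LinearMap.det (φ.linear : EuclideanSpace ℝ (Fin d) →ₗ[ℝ] EuclideanSpace ℝ (Fin d))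

open Filter Topology

/-! The new points serve to measure barycentric coordinates. Take a simplex `v` so large that `P`
lies near its centre. If the points of `Q` have nearly the same barycentric coordinates in a simplex
`v'` as those of `P` have in `v`, then the affine map carrying `v'` to `v` carries `Q` close to `P`.
So it suffices to control, for each pair of vertices `a`, `b`, the ratio of the coordinates at `a`
and `b` up to `O(h)` at the price of `O(log (1/h))` points (`forces_abs_baryCoord_div_sub_le`).

Choose a third vertex, which exists because `d ≥ 2`, and project from the remaining vertices onto
the triangle. Together with a unit point the triangle is a projective frame, and intersecting lines
produces points `[t : 1 : 0]` on its first side. Two projections replace `t` by `(t ± 1) / 2`, so a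
dyadic `t` within `2⁻ᵏ` of a target costs `6k` intersections (`exists_constructibleIn_near`). The
orientation of `x`, `[t : 1 : 0]` and the third vertex, completed by the remaining vertices, then
compares the frame ratio of `x` with `t`.

A generic chirotope cannot record the incidences of such a construction. Hence each intersection
point is replaced by four nearby points, one in each quadrant of the two lines. In any realization
some convex combination of these four lies on both lines; since determinants are affine in each
point, it also inherits every orientation on which the four agree (`Forces.of_incidences`). Later
points are kept while an earlier one is scattered, so the costs add instead of multiplying.

The frame of `Q` is known only up to rescaling its axes. Two far points, whose coordinates at `a`
and `b` nearly cancel, calibrate the scale: mere signs force these coordinates to have positive sum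
in `Q`. All this constrains only nonzero orientations (`IsSignCompatible`), so the final
configuration may be perturbed to a generic one (`Forces.exists_generic_extension`). -/

/-- Homogeneous coordinates of a point: its coordinates followed by `1`. -/
noncomputable def homCoord {d : ℕ} (x : EuclideanSpace ℝ (Fin d)) : Fin (d + 1) → ℝ :=
  Fin.snoc (fun k : Fin d => x k) 1

/-- The matrix whose columns are the homogeneous coordinates of the points `p j`. -/
noncomputable def homMatrix {d : ℕ} (p : Fin (d + 1) → EuclideanSpace ℝ (Fin d)) :
    Matrix (Fin (d + 1)) (Fin (d + 1)) ℝ :=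
  Matrix.of fun i j => homCoord (p j) i

/-- The determinant whose sign is the orientation of the tuple. -/
noncomputable def orientationDet {d : ℕ} (p : Fin (d + 1) → EuclideanSpace ℝ (Fin d)) : ℝ :=
  (homMatrix p).det

/-- Barycentric coordinates with respect to a nondegenerate tuple, by Cramer's rule. -/
noncomputable def baryCoord {d : ℕ} (p : Fin (d + 1) → EuclideanSpace ℝ (Fin d))
    (x : EuclideanSpace ℝ (Fin d)) (i : Fin (d + 1)) : ℝ :=
  orientationDet (Function.update p i x) / orientationDet p

/-! ### Determinants, Cramer's rule and barycentric coordinates -/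

section Determinants

variable {d : ℕ} {p : Fin (d + 1) → EuclideanSpace ℝ (Fin d)}

@[simp] theorem homCoord_last (x : EuclideanSpace ℝ (Fin d)) : homCoord x (Fin.last d) = 1 := by
  simp [homCoord]

@[simp] theorem homCoord_castSucc (x : EuclideanSpace ℝ (Fin d)) (k : Fin d) :
    homCoord x k.castSucc = x k := by
  simp [homCoord]

theorem homCoord_injective : Function.Injective (homCoord (d := d)) := by
  intro x y h
  ext k
  simpa using congrFun h k.castSucc

theorem homCoord_sum {ι : Type*} (s : Finset ι) (c : ι → ℝ) (hc : ∑ i ∈ s, c i = 1)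
    (x : ι → EuclideanSpace ℝ (Fin d)) :
    homCoord (∑ i ∈ s, c i • x i) = ∑ i ∈ s, c i • homCoord (x i) := by
  ext j
  refine Fin.lastCases ?_ (fun k => ?_) j
  · simp [Finset.sum_apply, hc]
  · simp [Finset.sum_apply]

theorem orientationDet_update (p : Fin (d + 1) → EuclideanSpace ℝ (Fin d)) (i : Fin (d + 1))
    (x : EuclideanSpace ℝ (Fin d)) :
    orientationDet (Function.update p i x) = (homMatrix p).cramer (homCoord x) i := by
  rw [Matrix.cramer_apply, orientationDet]
  congr 1
  ext k l
  by_cases h : l = i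
  · subst h; simp [homMatrix]
  · simp [homMatrix, h]

theorem baryCoord_eq (p : Fin (d + 1) → EuclideanSpace ℝ (Fin d)) (x : EuclideanSpace ℝ (Fin d)) :
    baryCoord p x = (orientationDet p)⁻¹ • (homMatrix p).cramer (homCoord x) := by
  ext i
  simp [baryCoord, orientationDet_update, div_eq_inv_mul]

theorem orientationDet_update_sum {ι : Type*} (s : Finset ι) (c : ι → ℝ) (hc : ∑ i ∈ s, c i = 1)
    (x : ι → EuclideanSpace ℝ (Fin d)) (p : Fin (d + 1) → EuclideanSpace ℝ (Fin d))
    (j : Fin (d + 1)) :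
    orientationDet (Function.update p j (∑ i ∈ s, c i • x i)) =
      ∑ i ∈ s, c i * orientationDet (Function.update p j (x i)) := by
  simp only [orientationDet_update, homCoord_sum s c hc, map_sum, map_smul, Finset.sum_apply,
    Pi.smul_apply, smul_eq_mul]

theorem baryCoord_sum {ι : Type*} (s : Finset ι) (c : ι → ℝ) (hc : ∑ i ∈ s, c i = 1)
    (x : ι → EuclideanSpace ℝ (Fin d)) (p : Fin (d + 1) → EuclideanSpace ℝ (Fin d))
    (j : Fin (d + 1)) :
    baryCoord p (∑ i ∈ s, c i • x i) j = ∑ i ∈ s, c i * baryCoord p (x i) j := by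
  simp only [baryCoord, orientationDet_update_sum s c hc, Finset.sum_div, mul_div_assoc]

theorem orientationDet_eq_zero_of_eq {i j : Fin (d + 1)} (hij : i ≠ j) (h : p i = p j) :
    orientationDet p = 0 :=
  Matrix.det_zero_of_column_eq hij fun k => by simp [homMatrix, h]

theorem baryCoord_self (hp : orientationDet p ≠ 0) (i j : Fin (d + 1)) :
    baryCoord p (p i) j = if j = i then 1 else 0 := by
  split_ifs with h
  · subst h; simp [baryCoord, hp]
  · rw [baryCoord, orientationDet_eq_zero_of_eq h, zero_div]
    simp [Function.update_of_ne (Ne.symm h)]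

theorem homMatrix_mulVec_baryCoord (hp : orientationDet p ≠ 0) (x : EuclideanSpace ℝ (Fin d)) :
    (homMatrix p).mulVec (baryCoord p x) = homCoord x := by
  rw [baryCoord_eq, Matrix.mulVec_smul, Matrix.mulVec_cramer, smul_smul]
  change ((orientationDet p)⁻¹ * orientationDet p) • _ = _
  rw [inv_mul_cancel₀ hp, one_smul]

theorem sum_baryCoord (hp : orientationDet p ≠ 0) (x : EuclideanSpace ℝ (Fin d)) :
    ∑ i, baryCoord p x i = 1 := by
  have h := congrFun (homMatrix_mulVec_baryCoord hp x) (Fin.last d)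
  simpa [Matrix.mulVec, dotProduct, homMatrix] using h

theorem sum_baryCoord_smul (hp : orientationDet p ≠ 0) (x : EuclideanSpace ℝ (Fin d)) :
    ∑ i, baryCoord p x i • p i = x := by
  apply homCoord_injective
  rw [homCoord_sum _ _ (sum_baryCoord hp x), ← homMatrix_mulVec_baryCoord hp x]
  ext k
  simp [Matrix.mulVec, dotProduct, homMatrix, Finset.sum_apply, mul_comm]

theorem baryCoord_of_sum (hp : orientationDet p ≠ 0) (c : Fin (d + 1) → ℝ) (hc : ∑ i, c i = 1) :
    baryCoord p (∑ i, c i • p i) = c := by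
  ext j
  rw [baryCoord_sum _ _ hc]
  simp [baryCoord_self hp]

theorem baryCoord_comp_sum (hp : orientationDet p ≠ 0) {ι : Type*} [Fintype ι]
    {f : ι → Fin (d + 1)} (hf : Function.Injective f) (c : ι → ℝ) (hc : ∑ i, c i = 1) (k : ι) :
    baryCoord p (∑ i, c i • p (f i)) (f k) = c k := by
  classical
  rw [baryCoord_sum _ _ hc]
  simp [baryCoord_self hp, hf.eq_iff]

/-- Replacing the points with positions in the range of `f` multiplies the determinant by the
corresponding minor of the matrix of barycentric coordinates. -/
theorem orientationDet_extend (hp : orientationDet p ≠ 0) {ι : Type*} [Fintype ι] [DecidableEq ι]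
    {f : ι → Fin (d + 1)} (hf : Function.Injective f) (x : ι → EuclideanSpace ℝ (Fin d)) :
    orientationDet (Function.extend f x p) =
      orientationDet p * (Matrix.of fun k l => baryCoord p (x l) (f k)).det := by
  let U : Matrix (Fin (d + 1)) ι ℝ :=
    Matrix.of fun i l => baryCoord p (x l) i - if i = f l then 1 else 0
  let V : Matrix ι (Fin (d + 1)) ℝ := Matrix.of fun l j => if j = f l then 1 else 0
  -- `W` is the identity with the columns at the positions `f l` replaced by the barycentric
  -- coordinates of `x l`. The identity `det (1 + U * V) = det (1 + V * U)` reduces its determinant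
  -- to the minor.
  let W : Matrix (Fin (d + 1)) (Fin (d + 1)) ℝ := 1 + U * V
  have h1 : homMatrix (Function.extend f x p) = homMatrix p * W := by
    ext k j
    by_cases hj : ∃ l, f l = j
    · obtain ⟨l, rfl⟩ := hj
      have hx := congrFun (homMatrix_mulVec_baryCoord hp (x l)) k
      have : ∀ i, W i (f l) = baryCoord p (x l) i := by
        intro i
        simp [W, U, V, Matrix.mul_apply, hf.eq_iff, Matrix.one_apply]
      simp only [Matrix.mul_apply, this]
      rw [show homMatrix (Function.extend f x p) k (f l) = homCoord (x l) k by
        simp [homMatrix, hf.extend_apply], ← hx]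
      rfl
    · have : ∀ i, W i j = (1 : Matrix _ _ ℝ) i j := by
        intro i
        have : ∀ l, j ≠ f l := fun l h => hj ⟨l, h.symm⟩
        simp [W, U, V, Matrix.mul_apply, this]
      rw [Matrix.mul_apply]
      simp only [this]
      rw [← Matrix.mul_apply, Matrix.mul_one]
      simp [homMatrix, Function.extend_apply' _ _ _ hj]
  have h2 : (1 + V * U) = Matrix.of fun k l => baryCoord p (x l) (f k) := by
    ext k l
    simp [U, V, Matrix.mul_apply, Matrix.one_apply, hf.eq_iff]
  rw [orientationDet, h1, Matrix.det_mul, Matrix.det_one_add_mul_comm, h2]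
  rfl

theorem continuous_orientationDet :
    Continuous (orientationDet : (Fin (d + 1) → EuclideanSpace ℝ (Fin d)) → ℝ) := by
  refine Continuous.matrix_det (continuous_matrix fun i j => ?_)
  refine Fin.lastCases ?_ (fun k => ?_) i
  · simpa [homMatrix] using continuous_const
  · simp only [homMatrix, Matrix.of_apply, homCoord_castSucc]
    fun_prop

theorem orientationDet_map (φ : EuclideanSpace ℝ (Fin d) →ᵃ[ℝ] EuclideanSpace ℝ (Fin d))
    (p : Fin (d + 1) → EuclideanSpace ℝ (Fin d)) :
    orientationDet (fun j => φ (p j)) = LinearMap.det φ.linear * orientationDet p := by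
  let b := (EuclideanSpace.basisFun (Fin d) ℝ).toBasis
  let A : Matrix (Fin d) (Fin d) ℝ := LinearMap.toMatrix b b φ.linear
  -- In homogeneous coordinates `φ` is the block matrix with linear part `A`, last column `φ 0` and
  -- last row `(0, …, 0, 1)`.
  let H : Matrix (Fin (d + 1)) (Fin (d + 1)) ℝ := Matrix.of fun i j =>
    (Fin.lastCases (if j = Fin.last d then 1 else 0)
      (fun k => (Fin.lastCases (φ 0 k) (fun l => A k l) j : ℝ)) i : ℝ)
  have hA : ∀ (x : EuclideanSpace ℝ (Fin d)) (k : Fin d),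
      φ x k = ∑ l, A k l * x l + φ 0 k := by
    intro x k
    have h1 : φ x = φ.linear x + φ 0 := congrFun (AffineMap.decomp φ) x
    have h2 : A.mulVec (b.repr x) = b.repr (φ.linear x) := LinearMap.toMatrix_mulVec_repr b b _ x
    have h3 := congrFun h2 k
    simp only [b, Matrix.mulVec, dotProduct] at h3
    rw [h1, PiLp.add_apply]
    congr 1
    exact h3.symm
  have hH : homMatrix (fun j => φ (p j)) = H * homMatrix p := by
    ext i j
    rw [Matrix.mul_apply, Fin.sum_univ_castSucc]
    refine Fin.lastCases ?_ (fun k => ?_) i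
    · have h1 : ∀ l : Fin d, H (Fin.last d) l.castSucc = 0 := fun l => by
        simp [H, (Fin.castSucc_lt_last _).ne]
      have h2 : H (Fin.last d) (Fin.last d) = 1 := by simp [H]
      simp only [h1, h2]
      simp [homMatrix]
    · have h1 : ∀ l : Fin d, H k.castSucc l.castSucc = A k l := fun l => by simp [H]
      have h2 : H k.castSucc (Fin.last d) = φ 0 k := by simp [H]
      simp only [h1, h2, homMatrix, Matrix.of_apply, homCoord_castSucc, homCoord_last, mul_one]
      exact hA _ _
  have hdet : H.det = A.det := by
    rw [Matrix.det_succ_row H (Fin.last d), Fin.sum_univ_castSucc]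
    have : ∀ k : Fin d, H (Fin.last d) k.castSucc = 0 := fun k => by
      simp [H, (Fin.castSucc_lt_last _).ne]
    simp only [this, mul_zero, zero_mul, Finset.sum_const_zero, zero_add]
    have h1 : H (Fin.last d) (Fin.last d) = 1 := by simp [H]
    have h2 : H.submatrix (Fin.last d).succAbove (Fin.last d).succAbove = A := by
      ext k l
      simp [H]
    rw [h1, h2]
    simp [← two_mul, pow_mul]
  rw [orientationDet, hH, Matrix.det_mul, hdet, LinearMap.det_toMatrix]
  rfl

end Determinants

/-! ### Forcing properties by sign conditions, and scattering of incidences -/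

/-- If a family of vectors meets every open orthant, then some convex combination of it is `0`. -/
theorem exists_convex_combination_eq_zero {K : Type*} [Fintype K] [DecidableEq K]
    (g : (K → Bool) → K → ℝ)
    (hg : ∀ σ k, 0 < (if σ k then 1 else -1) * g σ k) :
    ∃ c : (K → Bool) → ℝ, (∀ σ, 0 ≤ c σ) ∧ ∑ σ, c σ = 1 ∧ ∀ k, ∑ σ, c σ * g σ k = 0 := by
  let T : ((K → Bool) → ℝ) →ₗ[ℝ] (K → ℝ) := Fintype.linearCombination ℝ g
  have hT : ∀ c k, T c k = ∑ σ, c σ * g σ k := fun c k => by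
    simp [T, Fintype.linearCombination_apply, Finset.sum_apply]
  have hconv : Convex ℝ (T '' stdSimplex ℝ (K → Bool)) := (convex_stdSimplex ℝ _).linear_image T
  have hcl : IsClosed (T '' stdSimplex ℝ (K → Bool)) :=
    ((isCompact_stdSimplex ℝ _).image T.continuous_of_finiteDimensional).isClosed
  by_cases h0 : (0 : K → ℝ) ∈ T '' stdSimplex ℝ (K → Bool)
  · obtain ⟨c, hc, hc0⟩ := h0
    exact ⟨c, hc.1, hc.2, fun k => by rw [← hT, hc0, Pi.zero_apply]⟩
  · exfalso
    obtain ⟨f, u, hu, hf⟩ := geometric_hahn_banach_point_closed hconv hcl h0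
    -- The orthant opposite to the separating functional `f`: there `f` is nonpositive, although
    -- separation makes it positive on the hull.
    let σ : K → Bool := fun k => decide (f (Pi.single k 1) < 0)
    have h1 : g σ ∈ T '' stdSimplex ℝ (K → Bool) :=
      ⟨Pi.single σ 1, single_mem_stdSimplex ℝ σ, by ext k; simp [hT, Pi.single_apply]⟩
    have h2 := hf _ h1
    rw [map_zero] at hu
    have h3 : f (g σ) = ∑ k, g σ k * f (Pi.single k 1) := by
      conv_lhs => rw [pi_eq_sum_univ' (g σ)]
      simp [map_sum]
    have h4 : f (g σ) ≤ 0 := by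
      rw [h3]
      refine Finset.sum_nonpos fun k _ => ?_
      have := hg σ k
      by_cases hk : f (Pi.single k 1) < 0
      · simp only [σ, hk, decide_true, if_true, one_mul] at this
        exact mul_nonpos_of_nonneg_of_nonpos this.le hk.le
      · simp only [σ, hk, decide_false] at this
        exact mul_nonpos_of_nonpos_of_nonneg (by simpa using this.le) (not_lt.1 hk)
    linarith

/-- Every nonzero orientation of `P` is also an orientation of `Q`. -/
def IsSignCompatible {d : ℕ} {L : Type*} (P Q : PointConfig d L) : Prop :=
  ∀ t : Fin (d + 1) → L, orientationDet (P ∘ t) ≠ 0 →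
    SignType.sign (orientationDet (Q ∘ t)) = SignType.sign (orientationDet (P ∘ t))

/-- By adding at most `m` points to `B`, one can ensure that every configuration compatible with
the extended one restricts to a configuration with property `Φ`. -/
def Forces {d : ℕ} {L : Type*} (m : ℕ) (B : PointConfig d L) (Φ : PointConfig d L → Prop) : Prop :=
  ∃ (Y : Type) (_ : Fintype Y) (R : PointConfig d Y), Fintype.card Y ≤ m ∧
    ∀ Q : PointConfig d (L ⊕ Y), IsSignCompatible (Sum.elim B R) Q → Φ (Q ∘ Sum.inl)

/-- The configuration with one more point `w`, labeled by `none`. -/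
def adjoinPoint {d : ℕ} {L : Type*} (B : PointConfig d L) (w : EuclideanSpace ℝ (Fin d)) :
    PointConfig d (Option L) :=
  fun o => o.elim w B

section Forcing

variable {d : ℕ} {L : Type*} {B : PointConfig d L} {Φ Ψ : PointConfig d L → Prop} {m n : ℕ}

theorem IsSignCompatible.comp {L' : Type*} {P Q : PointConfig d L} (h : IsSignCompatible P Q)
    (f : L' → L) : IsSignCompatible (P ∘ f) (Q ∘ f) :=
  fun t ht => h (f ∘ t) ht

theorem Forces.mono (h : Forces m B Φ) (hmn : m ≤ n)
    (hΦ : ∀ Q, IsSignCompatible B Q → Φ Q → Ψ Q) : Forces n B Ψ := by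
  obtain ⟨Y, _, R, hY, hR⟩ := h
  exact ⟨Y, _, R, hY.trans hmn, fun Q hQ => hΦ _ (hQ.comp Sum.inl) (hR Q hQ)⟩

theorem forces_of_compatible (h : ∀ Q, IsSignCompatible B Q → Φ Q) : Forces m B Φ :=
  ⟨Empty, inferInstance, fun y => y.elim, by simp, fun _ hQ => h _ (hQ.comp Sum.inl)⟩

theorem Forces.and (h₁ : Forces m B Φ) (h₂ : Forces n B Ψ) :
    Forces (m + n) B fun Q => Φ Q ∧ Ψ Q := by
  obtain ⟨Y, _, R, hY, hR⟩ := h₁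
  obtain ⟨Z, _, S, hZ, hS⟩ := h₂
  refine ⟨Y ⊕ Z, inferInstance, Sum.elim R S, ?_, fun Q hQ => ⟨?_, ?_⟩⟩
  · rw [Fintype.card_sum]; omega
  · refine hR (Q ∘ Sum.map id Sum.inl) ?_
    convert hQ.comp (Sum.map id Sum.inl) using 1
    ext x; rcases x with x | x <;> rfl
  · refine hS (Q ∘ Sum.map id Sum.inr) ?_
    convert hQ.comp (Sum.map id Sum.inr) using 1
    ext x; rcases x with x | x <;> rfl

theorem forces_forall_mem {I : Type*} (s : Finset I) {Φ : I → PointConfig d L → Prop}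
    (h : ∀ i ∈ s, Forces m B (Φ i)) : Forces (s.card * m) B fun Q => ∀ i ∈ s, Φ i Q := by
  classical
  induction s using Finset.induction_on with
  | empty => exact forces_of_compatible (by simp)
  | insert a s ha ih =>
    refine ((h a (by simp)).and (ih fun i hi => h i (by simp [hi]))).mono ?_ fun Q _ hQ => ?_
    · rw [Finset.card_insert_of_notMem ha]; linarith
    · simpa using hQ

theorem forces_forall {I : Type*} [Fintype I] {Φ : I → PointConfig d L → Prop}
    (h : ∀ i, Forces m B (Φ i)) : Forces (Fintype.card I * m) B fun Q => ∀ i, Φ i Q :=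
  (forces_forall_mem Finset.univ fun i _ => h i).mono le_rfl fun Q _ hQ i => hQ i (by simp)

/-- The map `f` need be neither injective nor surjective. It thus serves both to forget auxiliary
points and to give a second label to a point already present, at no cost. -/
theorem Forces.of_comp {L' : Type*} (f : L' → L) {Φ : PointConfig d L' → Prop}
    (h : Forces m (B ∘ f) Φ) : Forces m B fun Q => Φ (Q ∘ f) := by
  obtain ⟨Y, _, R, hY, hR⟩ := h
  refine ⟨Y, _, R, hY, fun Q hQ => hR (Q ∘ Sum.map f id) ?_⟩
  convert hQ.comp (Sum.map f id) using 1
  ext x; rcases x with x | x <;> rfl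

/-- Auxiliary points may be counted among the new ones; their positions in `Q` are then only known
to exist. -/
theorem Forces.of_sum_elim {Z : Type} [Fintype Z] (F : PointConfig d Z)
    {Φ : PointConfig d (L ⊕ Z) → Prop} (h : Forces m (Sum.elim B F) Φ) :
    Forces (m + Fintype.card Z) B fun Q => ∃ F', Φ (Sum.elim Q F') := by
  obtain ⟨Y, _, R, hY, hR⟩ := h
  refine ⟨Z ⊕ Y, inferInstance, Sum.elim F R, ?_, fun Q hQ => ⟨Q ∘ Sum.inr ∘ Sum.inl, ?_⟩⟩
  · rw [Fintype.card_sum]; omega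
  · have := hR (Q ∘ (Equiv.sumAssoc L Z Y)) (by
      convert hQ.comp (Equiv.sumAssoc L Z Y) using 1
      ext x; rcases x with (x | x) | x <;> rfl)
    convert this using 1
    ext x; rcases x with x | x <;> rfl

theorem Forces.of_adjoinPoint (w : EuclideanSpace ℝ (Fin d))
    {Φ : PointConfig d (Option L) → Prop} (h : Forces m (adjoinPoint B w) Φ) :
    Forces (m + 1) B fun Q => ∃ w', Φ (adjoinPoint Q w') := by
  obtain ⟨Y, _, R, hY, hR⟩ := h
  refine ⟨Option Y, inferInstance, adjoinPoint R w, ?_, fun Q hQ => ⟨Q (Sum.inr none), ?_⟩⟩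
  · rw [Fintype.card_option]; omega
  · let f : Option L ⊕ Y → L ⊕ Option Y :=
      Sum.elim (fun o => o.elim (Sum.inr none) Sum.inl) (Sum.inr ∘ some)
    have := hR (Q ∘ f) (by
      convert hQ.comp f using 1
      ext x; rcases x with (_ | x) | x <;> rfl)
    convert this using 1
    ext x; rcases x with _ | x <;> rfl

/-- Multiaffinity: if `none` occurs at most once in `t`, then the determinant of `t` is affine in
the point labeled by `none`. -/
theorem orientationDet_sum_of_subsingleton {M I : Type*} [Fintype I] (c : I → ℝ) (hc : ∑ i, c i = 1)
    (x : I → EuclideanSpace ℝ (Fin d)) (a : M) (P : I → PointConfig d M) (P₀ : PointConfig d M)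
    (ha : ∀ i, P i a = x i) (ha₀ : P₀ a = ∑ i, c i • x i) (hP : ∀ i b, b ≠ a → P i b = P₀ b)
    (t : Fin (d + 1) → M) (ht : ∀ i j, t i = a → t j = a → i = j) :
    orientationDet (P₀ ∘ t) = ∑ i, c i * orientationDet (P i ∘ t) := by
  by_cases h : ∃ j, t j = a
  · obtain ⟨j, hj⟩ := h
    have hu : ∀ i, P i ∘ t = Function.update (P₀ ∘ t) j (x i) := fun i => by
      ext1 k
      by_cases hk : k = j
      · subst hk; simp [hj, ha]
      · simp [hk, hP i (t k) fun h => hk (ht k j h hj)]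
    have hu₀ : P₀ ∘ t = Function.update (P₀ ∘ t) j (∑ i, c i • x i) := by
      rw [← ha₀, ← hj]
      exact (Function.update_eq_self j (P₀ ∘ t)).symm
    rw [hu₀, orientationDet_update_sum _ _ hc]
    simp only [hu]
  · have hu : ∀ i, P i ∘ t = P₀ ∘ t := fun i => by
      ext1 k
      exact hP i (t k) fun hk => h ⟨k, hk⟩
    simp only [hu, ← Finset.sum_mul, hc, one_mul]

/-- A point `w` determined by incidences can be adjoined at the price of scattering it into the
orthants of the hyperplanes that define it: in each compatible configuration the incidences
define a point that is a convex combination of the scattered ones. -/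
theorem Forces.of_incidences [Finite L] {K : Type} [Fintype K] [DecidableEq K]
    (t : K → Fin (d + 1) → Option L) (ht : ∀ k i j, t k i = none → t k j = none → i = j)
    (w : EuclideanSpace ℝ (Fin d))
    (hw : ∀ σ : K → Bool, ∃ᶠ x in 𝓝 w, ∀ k,
      0 < (if σ k then 1 else -1) * orientationDet (adjoinPoint B x ∘ t k))
    {Φ : PointConfig d (Option L) → Prop} (h : Forces m (adjoinPoint B w) Φ) :
    Forces (m + 2 ^ Fintype.card K) B fun Q =>
      ∃ w', (∀ k, orientationDet (adjoinPoint Q w' ∘ t k) = 0) ∧ Φ (adjoinPoint Q w') := by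
  obtain ⟨Y, _, R, hY, hR⟩ := h
  -- Moving `w` slightly destroys no nonzero orientation, including those with the later points `R`.
  -- All scattered points therefore agree on these signs, and the signs pass to convex combinations.
  have hclose : ∀ᶠ x in 𝓝 w, ∀ s : Fin (d + 1) → Option L ⊕ Y,
      orientationDet (Sum.elim (adjoinPoint B w) R ∘ s) ≠ 0 →
      SignType.sign (orientationDet (Sum.elim (adjoinPoint B x) R ∘ s)) =
        SignType.sign (orientationDet (Sum.elim (adjoinPoint B w) R ∘ s)) := by
    refine eventually_all.2 fun s => ?_
    by_cases hs : orientationDet (Sum.elim (adjoinPoint B w) R ∘ s) = 0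
    · exact Eventually.of_forall fun x hx => absurd hs hx
    · have hcont : Continuous fun x => orientationDet (Sum.elim (adjoinPoint B x) R ∘ s) := by
        refine continuous_orientationDet.comp (continuous_pi fun i => ?_)
        rcases hi : s i with (_ | y) | y <;> simp [hi, adjoinPoint] <;> fun_prop
      rcases lt_or_gt_of_ne hs with h0 | h0
      · filter_upwards [(hcont.tendsto w).eventually_lt_const h0] with x hx _
        rw [sign_neg hx, sign_neg h0]
      · filter_upwards [(hcont.tendsto w).eventually_const_lt h0] with x hx _
        rw [sign_pos hx, sign_pos h0]
  choose x hxt hxs using fun σ : K → Bool => ((hw σ).and_eventually hclose).exists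
  refine ⟨Y ⊕ (K → Bool), inferInstance, Sum.elim R x, ?_, fun Q hQ => ?_⟩
  · simp only [Fintype.card_sum, Fintype.card_fun, Fintype.card_bool]; omega
  let f : (K → Bool) → Option L ⊕ Y → L ⊕ (Y ⊕ (K → Bool)) := fun σ =>
    Sum.elim (fun o => o.elim (Sum.inr (Sum.inr σ)) Sum.inl) (Sum.inr ∘ Sum.inl)
  have hf : ∀ σ, Sum.elim B (Sum.elim R x) ∘ f σ = Sum.elim (adjoinPoint B (x σ)) R := fun σ => by
    ext o; rcases o with (_ | o) | o <;> rfl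
  have hQf : ∀ σ, IsSignCompatible (Sum.elim (adjoinPoint B (x σ)) R) (Q ∘ f σ) := fun σ => by
    rw [← hf]; exact hQ.comp (f σ)
  obtain ⟨c, hc0, hc1, hc⟩ := exists_convex_combination_eq_zero
    (fun σ k => orientationDet ((Q ∘ f σ) ∘ Sum.inl ∘ t k)) (fun σ k => by
      have h1 := hxt σ k
      have h2 : SignType.sign (orientationDet ((Q ∘ f σ) ∘ Sum.inl ∘ t k)) =
          SignType.sign (orientationDet (adjoinPoint B (x σ) ∘ t k)) :=
        hQf σ (Sum.inl ∘ t k) (by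
          intro h0
          change orientationDet (adjoinPoint B (x σ) ∘ t k) = 0 at h0
          rw [h0] at h1; simp at h1)
      rw [← sign_eq_one_iff, sign_mul] at h1 ⊢
      rwa [h2])
  let x' : (K → Bool) → EuclideanSpace ℝ (Fin d) := fun σ => Q (Sum.inr (Sum.inr σ))
  let P₀ : PointConfig d (Option L ⊕ Y) :=
    Sum.elim (adjoinPoint (Q ∘ Sum.inl) (∑ σ, c σ • x' σ)) (Q ∘ Sum.inr ∘ Sum.inl)
  have haff : ∀ s : Fin (d + 1) → Option L ⊕ Y,
      (∀ i j, s i = Sum.inl none → s j = Sum.inl none → i = j) →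
      orientationDet (P₀ ∘ s) = ∑ σ, c σ * orientationDet ((Q ∘ f σ) ∘ s) :=
    fun s hs => orientationDet_sum_of_subsingleton c hc1 x' (Sum.inl none) (fun σ => Q ∘ f σ) P₀
      (fun _ => rfl) rfl
      (fun σ b hb => by rcases b with (_ | b) | b; exacts [absurd rfl hb, rfl, rfl]) s hs
  refine ⟨∑ σ, c σ • x' σ, fun k => ?_, ?_⟩
  · rw [← hc k]
    exact haff (Sum.inl ∘ t k) fun i j hi hj => ht k i j (Sum.inl_injective hi)
      (Sum.inl_injective hj)
  · refine hR P₀ fun s hs => ?_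
    -- A tuple containing `w` twice has determinant zero, so `hs` excludes it and the determinant is
    -- affine in the adjoined point.
    have hone : ∀ i j, s i = Sum.inl none → s j = Sum.inl none → i = j := by
      intro i j hi hj
      by_contra hij
      exact hs (orientationDet_eq_zero_of_eq hij (by simp [hi, hj]))
    rw [haff s hone]
    have hsig : ∀ σ, SignType.sign (orientationDet ((Q ∘ f σ) ∘ s)) =
        SignType.sign (orientationDet (Sum.elim (adjoinPoint B w) R ∘ s)) := fun σ => by
      have h1 := hxs σ s hs
      rw [← h1]
      refine hQf σ s fun h0 => hs ?_
      rwa [h0, sign_zero, eq_comm, sign_eq_zero_iff] at h1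
    obtain ⟨σ₀, hσ₀⟩ : ∃ σ, 0 < c σ := by
      by_contra! hn
      have : ∑ σ, c σ ≤ 0 := Finset.sum_nonpos fun σ _ => hn σ
      linarith
    rcases lt_or_gt_of_ne hs with h0 | h0
    · simp only [sign_neg h0, sign_eq_neg_one_iff] at hsig ⊢
      exact Finset.sum_neg' (fun σ _ => mul_nonpos_of_nonneg_of_nonpos (hc0 σ) (hsig σ).le)
        ⟨σ₀, Finset.mem_univ _, mul_neg_of_pos_of_neg hσ₀ (hsig σ₀)⟩
    · simp only [sign_pos h0, sign_eq_one_iff] at hsig ⊢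
      exact Finset.sum_pos' (fun σ _ => mul_nonneg (hc0 σ) (hsig σ).le)
        ⟨σ₀, Finset.mem_univ _, mul_pos hσ₀ (hsig σ₀)⟩

end Forcing

/-! ### Projective frames and constructions by intersecting lines -/

open Matrix in
theorem exists_smul_of_dotProduct_eq_zero {a n₁ n₂ y : Fin 3 → ℝ} {c : ℝ} (hc : c ≠ 0)
    (hy : y ≠ 0) (h₁ : a ⬝ᵥ n₁ = 0) (h₂ : a ⬝ᵥ n₂ = 0) (hn : crossProduct n₁ n₂ = c • y) :
    ∃ μ : ℝ, a = μ • y := by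
  obtain ⟨k, hk⟩ := Function.ne_iff.1 hy
  have key : crossProduct a y = 0 := by
    -- By the expansion `a × (n₁ × n₂) = (a · n₂) n₁ - (a · n₁) n₂`.
    have h3 : crossProduct a (crossProduct n₁ n₂) = 0 := by
      rw [vec3_dotProduct] at h₁ h₂
      simp only [cross_apply]
      ext i
      fin_cases i <;> simp
      · linear_combination n₁ 0 * h₂ - n₂ 0 * h₁
      · linear_combination n₁ 1 * h₂ - n₂ 1 * h₁
      · linear_combination n₁ 2 * h₂ - n₂ 2 * h₁
    rw [hn, map_smul] at h3
    exact (smul_eq_zero.1 h3).resolve_left hc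
  rw [cross_apply] at key
  have e0 : a 1 * y 2 - a 2 * y 1 = 0 := congrFun key 0
  have e1 : a 2 * y 0 - a 0 * y 2 = 0 := congrFun key 1
  have e2 : a 0 * y 1 - a 1 * y 0 = 0 := congrFun key 2
  refine ⟨a k / y k, ?_⟩
  have hk' : y k ≠ 0 := hk
  ext i
  rw [Pi.smul_apply, smul_eq_mul, div_mul_eq_mul_div, eq_div_iff hk']
  fin_cases k <;> fin_cases i <;> simp <;> linarith

/-- Weights of the point with projective coordinates `(1, 1, 1)` in the frame of a triangle. They
are chosen so that no point constructed below lies at infinity. -/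
def frameWeight : Fin 3 → ℝ := ![3, 2, 8]

/-- The linear form that vanishes at the points at infinity. -/
def frameForm (y : Fin 3 → ℝ) : ℝ := ∑ i, frameWeight i * y i

/-- The point with projective coordinates `y` in the frame of the triangle with vertices
`p (ι i)`. -/
noncomputable def framePoint {d : ℕ} (ι : Fin 3 → Fin (d + 1))
    (p : Fin (d + 1) → EuclideanSpace ℝ (Fin d)) (y : Fin 3 → ℝ) : EuclideanSpace ℝ (Fin d) :=
  ∑ i, (frameWeight i * y i / frameForm y) • p (ι i)

/-- The barycentric coordinates of `x` at the positions `ι i` are proportional to `lam i * y i`. -/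
def HasFrameCoord {d : ℕ} (ι : Fin 3 → Fin (d + 1)) (p : Fin (d + 1) → EuclideanSpace ℝ (Fin d))
    (lam : Fin 3 → ℝ) (x : EuclideanSpace ℝ (Fin d)) (y : Fin 3 → ℝ) : Prop :=
  ∃ μ : ℝ, μ ≠ 0 ∧ ∀ i, baryCoord p x (ι i) = μ * (lam i * y i)

/-- The points of the projective plane that can be obtained from the standard frame by
intersecting lines, counted with the number of intersections. -/
inductive ConstructibleIn : ℕ → (Fin 3 → ℝ) → Prop
  | basis (i : Fin 3) : ConstructibleIn 0 (Pi.single i 1)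
  | unit : ConstructibleIn 0 1
  | meet {n₁ n₂ n₃ n₄ : ℕ} {y₁ y₂ y₃ y₄ y : Fin 3 → ℝ} (c : ℝ)
      (h₁ : ConstructibleIn n₁ y₁) (h₂ : ConstructibleIn n₂ y₂)
      (h₃ : ConstructibleIn n₃ y₃) (h₄ : ConstructibleIn n₄ y₄) (hc : c ≠ 0)
      (hy : crossProduct (crossProduct y₁ y₂) (crossProduct y₃ y₄) = c • y)
      (hσ : frameForm y ≠ 0) : ConstructibleIn (n₁ + n₂ + n₃ + n₄ + 1) y

section Construction

variable {d : ℕ} {ι : Fin 3 → Fin (d + 1)} {p : Fin (d + 1) → EuclideanSpace ℝ (Fin d)}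

theorem frameWeight_pos (i : Fin 3) : 0 < frameWeight i := by
  fin_cases i <;> norm_num [frameWeight]

theorem frameForm_eq (y : Fin 3 → ℝ) : frameForm y = 3 * y 0 + 2 * y 1 + 8 * y 2 := by
  rw [frameForm, Fin.sum_univ_three]
  rfl

theorem frameForm_ne_zero_left {y : Fin 3 → ℝ} (h : frameForm y ≠ 0) : y ≠ 0 := by
  rintro rfl
  simp [frameForm] at h

theorem ConstructibleIn.frameForm_ne_zero {n : ℕ} {y : Fin 3 → ℝ} (h : ConstructibleIn n y) :
    frameForm y ≠ 0 := by
  cases h with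
  | basis i => simpa [frameForm, Pi.single_apply] using (frameWeight_pos i).ne'
  | unit => norm_num [frameForm_eq]
  | meet c _ _ _ _ _ _ hσ => exact hσ

theorem baryCoord_framePoint (hι : Function.Injective ι) (hp : orientationDet p ≠ 0)
    {y : Fin 3 → ℝ} (hy : frameForm y ≠ 0) (i : Fin 3) :
    baryCoord p (framePoint ι p y) (ι i) = frameWeight i * y i / frameForm y := by
  refine baryCoord_comp_sum hp hι (fun i => frameWeight i * y i / frameForm y) ?_ i
  rw [← Finset.sum_div]
  exact div_self hy

theorem hasFrameCoord_framePoint (hι : Function.Injective ι) (hp : orientationDet p ≠ 0)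
    {y : Fin 3 → ℝ} (hy : frameForm y ≠ 0) :
    HasFrameCoord ι p frameWeight (framePoint ι p y) y :=
  ⟨(frameForm y)⁻¹, inv_ne_zero hy, fun i => by
    rw [baryCoord_framePoint hι hp hy, div_eq_inv_mul]⟩

open Matrix in
/-- Collinearity in the projection to the triangle, in terms of frame coordinates. -/
theorem exists_orientationDet_eq_dotProduct (hι : Function.Injective ι) (hp : orientationDet p ≠ 0)
    {lam y₁ y₂ : Fin 3 → ℝ} (hlam : ∀ i, lam i ≠ 0) {x₁ x₂ : EuclideanSpace ℝ (Fin d)}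
    (h₁ : HasFrameCoord ι p lam x₁ y₁) (h₂ : HasFrameCoord ι p lam x₂ y₂) :
    ∃ c : ℝ, c ≠ 0 ∧ ∀ x a, (∀ i, baryCoord p x (ι i) = lam i * a i) →
      orientationDet (Function.extend ι ![x, x₁, x₂] p) = c * (a ⬝ᵥ crossProduct y₁ y₂) := by
  obtain ⟨μ₁, hμ₁, e₁⟩ := h₁
  obtain ⟨μ₂, hμ₂, e₂⟩ := h₂
  refine ⟨orientationDet p * (μ₁ * μ₂ * (lam 0 * lam 1 * lam 2)), ?_, fun x a ha => ?_⟩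
  · have := hlam 0; have := hlam 1; have := hlam 2
    positivity
  · rw [orientationDet_extend hp hι, Matrix.det_fin_three, cross_apply, vec3_dotProduct]
    simp [ha, e₁, e₂]
    ring

/-- This tuple tests incidence of `x` with the line through `B a` and `B b` after projection to the
triangle: the `d - 2` vertices outside the range of `ι` are kept. -/
theorem comp_extend_adjoinPoint {L : Type*} (B : PointConfig d L) (v : Fin (d + 1) → L)
    (x : EuclideanSpace ℝ (Fin d)) (a b : L) (hι : Function.Injective ι) :
    adjoinPoint B x ∘ Function.extend ι ![none, some a, some b] (some ∘ v) =
      Function.extend ι ![x, B a, B b] (B ∘ v) := by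
  ext1 j
  by_cases h : ∃ i, ι i = j
  · obtain ⟨i, rfl⟩ := h
    rw [Function.comp_apply, hι.extend_apply, hι.extend_apply]
    fin_cases i <;> rfl
  · rw [Function.comp_apply, Function.extend_apply' _ _ _ h, Function.extend_apply' _ _ _ h]
    rfl

theorem eq_of_extend_eq_none {L : Type*} (v : Fin (d + 1) → L) (a b : L)
    (hι : Function.Injective ι) {i : Fin (d + 1)}
    (h : Function.extend ι ![none, some a, some b] (some ∘ v) i = none) : i = ι 0 := by
  by_cases hi : ∃ k, ι k = i
  · obtain ⟨k, rfl⟩ := hi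
    rw [hι.extend_apply] at h
    fin_cases k <;> simp_all
  · rw [Function.extend_apply' _ _ _ hi] at h
    simp at h

theorem IsSignCompatible.orientationDet_ne_zero {L : Type*} {P Q : PointConfig d L}
    (h : IsSignCompatible P Q) {t : Fin (d + 1) → L} (ht : orientationDet (P ∘ t) ≠ 0) :
    orientationDet (Q ∘ t) ≠ 0 := by
  rw [← sign_ne_zero, h t ht]
  exact sign_ne_zero.2 ht

/-- A barycentric coordinate is a quotient of two orientation determinants, and compatibility
preserves the signs of both. -/
theorem IsSignCompatible.sign_baryCoord {L : Type*} {P Q : PointConfig d L}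
    (h : IsSignCompatible P Q) {v : Fin (d + 1) → L} (hv : orientationDet (P ∘ v) ≠ 0) {x : L}
    {i : Fin (d + 1)} (hx : baryCoord (P ∘ v) (P x) i ≠ 0) :
    SignType.sign (baryCoord (Q ∘ v) (Q x) i) = SignType.sign (baryCoord (P ∘ v) (P x) i) := by
  have hu : ∀ R : PointConfig d L, Function.update (R ∘ v) i (R x) = R ∘ Function.update v i x :=
    fun R => (Function.comp_update R v i x).symm
  rw [baryCoord, hu] at hx
  have hsign : ∀ a b : ℝ, SignType.sign (a / b) = SignType.sign a * SignType.sign b := fun a b => by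
    rw [← sign_mul]
    rcases lt_trichotomy b 0 with hb | rfl | hb
    · rcases lt_trichotomy a 0 with ha | rfl | ha
      · rw [sign_pos (div_pos_of_neg_of_neg ha hb), sign_pos (mul_pos_of_neg_of_neg ha hb)]
      · simp
      · rw [sign_neg (div_neg_of_pos_of_neg ha hb), sign_neg (mul_neg_of_pos_of_neg ha hb)]
    · simp
    · rcases lt_trichotomy a 0 with ha | rfl | ha
      · rw [sign_neg (div_neg_of_neg_of_pos ha hb), sign_neg (mul_neg_of_neg_of_pos ha hb)]
      · simp
      · rw [sign_pos (div_pos ha hb), sign_pos (mul_pos ha hb)]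
  rw [baryCoord, baryCoord, hu, hu, hsign, hsign, h _ hv, h _ (div_ne_zero_iff.1 hx).1]

open Matrix in
/-- Near a point of the intersection of two lines there are points on all sides of the lines. -/
theorem frequently_orientationDet_pos {L : Type*} {B : PointConfig d L} (hι : Function.Injective ι)
    (v : Fin (d + 1) → L) (hv : orientationDet (B ∘ v) ≠ 0) {y₁ y₂ y₃ y₄ y : Fin 3 → ℝ} {c : ℝ}
    (hc : c ≠ 0) (hy : crossProduct (crossProduct y₁ y₂) (crossProduct y₃ y₄) = c • y)
    (hσ : frameForm y ≠ 0) {a₁ a₂ a₃ a₄ : L}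
    (h₁ : HasFrameCoord ι (B ∘ v) frameWeight (B a₁) y₁)
    (h₂ : HasFrameCoord ι (B ∘ v) frameWeight (B a₂) y₂)
    (h₃ : HasFrameCoord ι (B ∘ v) frameWeight (B a₃) y₃)
    (h₄ : HasFrameCoord ι (B ∘ v) frameWeight (B a₄) y₄) (σ : Bool → Bool) :
    ∃ᶠ x in 𝓝 (framePoint ι (B ∘ v) y), ∀ k : Bool,
      0 < (if σ k then 1 else -1) * orientationDet (adjoinPoint B x ∘
        Function.extend ι ![none, some (bif k then a₁ else a₃), some (bif k then a₂ else a₄)]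
          (some ∘ v)) := by
  obtain ⟨G₁, hG₁, e₁⟩ := exists_orientationDet_eq_dotProduct hι hv
    (fun i => (frameWeight_pos i).ne') h₁ h₂
  obtain ⟨G₂, hG₂, e₂⟩ := exists_orientationDet_eq_dotProduct hι hv
    (fun i => (frameWeight_pos i).ne') h₃ h₄
  set n₁ := crossProduct y₁ y₂
  set n₂ := crossProduct y₃ y₄
  have hyn₁ : y ⬝ᵥ n₁ = 0 := by
    have := dot_self_cross n₁ n₂
    rw [hy, dotProduct_smul, smul_eq_zero, dotProduct_comm] at this
    exact this.resolve_left hc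
  have hyn₂ : y ⬝ᵥ n₂ = 0 := by
    have := dot_cross_self n₁ n₂
    rw [hy, dotProduct_smul, smul_eq_zero, dotProduct_comm] at this
    exact this.resolve_left hc
  let s : Bool → ℝ := fun k => if σ k then 1 else -1
  have hs : ∀ k, s k * s k = 1 := fun k => by by_cases h : σ k <;> simp [s, h]
  -- The vectors `n₂ × frameWeight` and `n₁ × frameWeight` span the directions with `frameForm`
  -- zero, and each is orthogonal to one of the two line normals. The coefficients solve `G₁ * (δ ·
  -- n₁) = s true` and `G₂ * (δ · n₂) = s false`; they are defined because the lines meet at a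
  -- finite point.
  let α₁ := s true / (G₁ * (c * frameForm y))
  let α₂ := -(s false / (G₂ * (c * frameForm y)))
  let δ : Fin 3 → ℝ := α₁ • crossProduct n₂ frameWeight + α₂ • crossProduct n₁ frameWeight
  have hcross : frameWeight ⬝ᵥ crossProduct n₁ n₂ = c * frameForm y := by
    rw [hy, dotProduct_smul, smul_eq_mul]; rfl
  have hδ₁ : G₁ * (δ ⬝ᵥ n₁) = s true := by
    have : δ ⬝ᵥ n₁ = α₁ * (c * frameForm y) := by
      rw [← hcross]
      simp only [δ, cross_apply, vec3_dotProduct, Pi.add_apply, Pi.smul_apply, smul_eq_mul]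
      simp
      ring
    rw [this]; simp only [α₁]; field_simp
  have hδ₂ : G₂ * (δ ⬝ᵥ n₂) = s false := by
    have : δ ⬝ᵥ n₂ = -α₂ * (c * frameForm y) := by
      rw [← hcross]
      simp only [δ, cross_apply, vec3_dotProduct, Pi.add_apply, Pi.smul_apply, smul_eq_mul]
      simp
      ring
    rw [this]; simp only [α₂]; field_simp
  have hδσ : frameForm δ = 0 := by
    simp only [frameForm, Fin.sum_univ_three, δ, cross_apply, Pi.add_apply, Pi.smul_apply,
      smul_eq_mul]
    simp
    ring
  let z : ℝ → Fin 3 → ℝ := fun r => (frameForm y)⁻¹ • y + r • δ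
  have hform : ∀ r, frameForm (z r) = 1 := fun r => by
    have : frameForm (z r) = (frameForm y)⁻¹ * frameForm y + r * frameForm δ := by
      simp only [frameForm, Fin.sum_univ_three, z, Pi.add_apply, Pi.smul_apply, smul_eq_mul]
      ring
    rw [this, hδσ, inv_mul_cancel₀ hσ]; ring
  have hx : ∀ r i, baryCoord (B ∘ v) (framePoint ι (B ∘ v) (z r)) (ι i) =
      frameWeight i * z r i := fun r i => by
    rw [baryCoord_framePoint hι hv (by rw [hform]; exact one_ne_zero), hform, div_one]
  have hlim : Tendsto (fun r => framePoint ι (B ∘ v) (z r)) (𝓝[>] 0)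
      (𝓝 (framePoint ι (B ∘ v) y)) := by
    have h0 : framePoint ι (B ∘ v) y = framePoint ι (B ∘ v) (z 0) := by
      have h1 := hform 0
      unfold framePoint
      rw [h1]
      refine Finset.sum_congr rfl fun i _ => ?_
      simp only [z, zero_smul, add_zero, Pi.smul_apply, smul_eq_mul]
      congr 1
      field_simp
    rw [h0]
    refine (Continuous.tendsto ?_ 0).mono_left nhdsWithin_le_nhds
    simp only [framePoint, hform, z]
    fun_prop
  refine hlim.frequently (Eventually.frequently ?_)
  filter_upwards [self_mem_nhdsWithin] with r hr
  have hr : 0 < r := hr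
  have hd : ∀ n : Fin 3 → ℝ, y ⬝ᵥ n = 0 → z r ⬝ᵥ n = r * (δ ⬝ᵥ n) := fun n hn => by
    simp only [z, add_dotProduct, smul_dotProduct, hn, smul_eq_mul]
    ring
  rintro (_ | _)
  · rw [comp_extend_adjoinPoint _ _ _ _ _ hι]
    have := e₂ _ _ (hx r)
    simp only [cond_false] at this ⊢
    rw [this, hd _ hyn₂]
    change 0 < s false * _
    rw [show s false * (G₂ * (r * (δ ⬝ᵥ n₂))) = r * (s false * (G₂ * (δ ⬝ᵥ n₂))) by ring, hδ₂, hs]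
    simpa using hr
  · rw [comp_extend_adjoinPoint _ _ _ _ _ hι]
    have := e₁ _ _ (hx r)
    simp only [cond_true] at this ⊢
    rw [this, hd _ hyn₁]
    change 0 < s true * _
    rw [show s true * (G₁ * (r * (δ ⬝ᵥ n₁))) = r * (s true * (G₁ * (δ ⬝ᵥ n₁))) by ring, hδ₁, hs]
    simpa using hr

/-- The barycentric coordinates of the point labeled `u` at the positions `ι i`. -/
noncomputable def unitCoord {L : Type*} (ι : Fin 3 → Fin (d + 1)) (Q : PointConfig d L)
    (v : Fin (d + 1) → L) (u : L) (i : Fin 3) : ℝ :=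
  baryCoord (Q ∘ v) (Q u) (ι i)

/-- The weights are positive, so the unit point has positive coordinates on the triangle, and signs
persist. Hence the unknown scales of the frame of `Q` are nonzero and do not affect signs. -/
theorem IsSignCompatible.unitCoord_pos {L : Type*} {B Q : PointConfig d L}
    (hι : Function.Injective ι) (h : IsSignCompatible B Q) {v : Fin (d + 1) → L} {u : L}
    (hv : orientationDet (B ∘ v) ≠ 0) (hu : B u = framePoint ι (B ∘ v) 1) (i : Fin 3) :
    0 < unitCoord ι Q v u i := by
  have hpos : 0 < baryCoord (B ∘ v) (B u) (ι i) := by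
    rw [hu, baryCoord_framePoint hι hv ConstructibleIn.unit.frameForm_ne_zero]
    have : 0 < frameForm 1 := by norm_num [frameForm_eq]
    have := frameWeight_pos i
    simp only [Pi.one_apply]
    positivity
  rw [unitCoord, ← sign_eq_one_iff, h.sign_baryCoord hv hpos.ne', sign_eq_one_iff]
  exact hpos

/-- A constructible point can be adjoined at a cost proportional to the length of its
construction: every compatible configuration determines a point with the same coordinates in its
own frame. -/
theorem ConstructibleIn.forces {n : ℕ} {y : Fin 3 → ℝ} (hy : ConstructibleIn n y)
    (hι : Function.Injective ι) {L : Type*} [Finite L] {B : PointConfig d L}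
    (v : Fin (d + 1) → L) (u : L) (hv : orientationDet (B ∘ v) ≠ 0)
    (hu : B u = framePoint ι (B ∘ v) 1) {m : ℕ} {Φ : PointConfig d (Option L) → Prop}
    (h : Forces m (adjoinPoint B (framePoint ι (B ∘ v) y)) Φ) :
    Forces (m + 4 * n) B fun Q =>
      ∃ w, HasFrameCoord ι (Q ∘ v) (unitCoord ι Q v u) w y ∧ Φ (adjoinPoint Q w) := by
  induction hy generalizing L m with
  | basis i =>
    have hw : framePoint ι (B ∘ v) (Pi.single i 1) = B (v (ι i)) := by
      have : frameForm (Pi.single i 1) = frameWeight i := by simp [frameForm, Pi.single_apply]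
      rw [framePoint, this, Finset.sum_eq_single i (fun j _ hj => by simp [hj]) (by simp)]
      simp [(frameWeight_pos i).ne']
    let f : Option L → L := fun o => o.elim (v (ι i)) id
    have hf : ∀ R : PointConfig d L, R ∘ f = adjoinPoint R (R (v (ι i))) := fun R => by
      ext1 o; rcases o with _ | o <;> rfl
    rw [hw, ← hf] at h
    refine (Forces.of_comp f h).mono (by simp) fun Q hQ hΦ => ⟨Q (v (ι i)), ?_, by rwa [← hf]⟩
    have hpos := hQ.unitCoord_pos hι hv hu i
    refine ⟨(unitCoord ι Q v u i)⁻¹, inv_ne_zero hpos.ne', fun j => ?_⟩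
    have := baryCoord_self (hQ.orientationDet_ne_zero hv) (ι i) (ι j)
    rw [Function.comp_apply] at this
    rw [this]
    by_cases hji : j = i
    · subst hji; simp [hpos.ne']
    · simp [hji, hι.eq_iff]
  | unit =>
    let f : Option L → L := fun o => o.elim u id
    have hf : ∀ R : PointConfig d L, R ∘ f = adjoinPoint R (R u) := fun R => by
      ext1 o; rcases o with _ | o <;> rfl
    rw [← hu, ← hf] at h
    exact (Forces.of_comp f h).mono (by simp) fun Q hQ hΦ =>
      ⟨Q u, ⟨1, one_ne_zero, fun j => by simp [unitCoord]⟩, by rwa [← hf]⟩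
  | @meet n₁ n₂ n₃ n₄ y₁ y₂ y₃ y₄ y c h₁ h₂ h₃ h₄ hc hy hσ ih₁ ih₂ ih₃ ih₄ =>
    let w := framePoint ι (B ∘ v) y
    let B₁ := adjoinPoint B (framePoint ι (B ∘ v) y₁)
    let B₂ := adjoinPoint B₁ (framePoint ι (B ∘ v) y₂)
    let B₃ := adjoinPoint B₂ (framePoint ι (B ∘ v) y₃)
    let B₄ := adjoinPoint B₃ (framePoint ι (B ∘ v) y₄)
    let v₁ : Fin (d + 1) → Option L := some ∘ v
    let v₂ : Fin (d + 1) → Option (Option L) := some ∘ v₁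
    let v₃ : Fin (d + 1) → Option (Option (Option L)) := some ∘ v₂
    let v₄ : Fin (d + 1) → Option (Option (Option (Option L))) := some ∘ v₃
    let a₄ : Option (Option (Option (Option L))) := none
    let a₃ : Option (Option (Option (Option L))) := some none
    let a₂ : Option (Option (Option (Option L))) := some (some none)
    let a₁ : Option (Option (Option (Option L))) := some (some (some none))
    let g : Option L → Option (Option (Option (Option (Option L)))) :=
      Option.map fun x => some (some (some (some x)))
    have hg : ∀ (R : PointConfig d L) x₁ x₂ x₃ x₄ x, adjoinPoint (adjoinPoint (adjoinPoint
        (adjoinPoint (adjoinPoint R x₁) x₂) x₃) x₄) x ∘ g = adjoinPoint R x :=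
      fun R x₁ x₂ x₃ x₄ x => by ext1 o; rcases o with _ | o <;> rfl
    -- Compatibility is carried along inside the property: it is needed at the end to exclude that
    -- the point found in `Q` projects to zero.
    have h5 : Forces m (adjoinPoint B₄ w) fun Q =>
        IsSignCompatible (adjoinPoint B₄ w) Q ∧ Φ (Q ∘ g) := by
      refine Forces.mono (Forces.of_comp g (B := adjoinPoint B₄ w) (Φ := Φ) ?_) le_rfl
        fun Q hQ hΦ => ⟨hQ, hΦ⟩
      rw [hg]; exact h
    have hfc := fun {y : Fin 3 → ℝ} (hy : frameForm y ≠ 0) => hasFrameCoord_framePoint hι hv hy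
    have h4 := Forces.of_incidences (K := Bool)
      (fun k => Function.extend ι ![none, some (bif k then a₁ else a₃),
        some (bif k then a₂ else a₄)] (some ∘ v₄))
      (fun k i j hi hj =>
        (eq_of_extend_eq_none v₄ _ _ hι hi).trans (eq_of_extend_eq_none v₄ _ _ hι hj).symm) w
      (frequently_orientationDet_pos (B := B₄) hι v₄ hv hc hy hσ
        (hfc h₁.frameForm_ne_zero) (hfc h₂.frameForm_ne_zero)
        (hfc h₃.frameForm_ne_zero) (hfc h₄.frameForm_ne_zero)) h5
    have h3 := ih₄ (B := B₃) v₃ (some (some (some u))) hv hu h4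
    have h2 := ih₃ (B := B₂) v₂ (some (some u)) hv hu h3
    have h1 := ih₂ (B := B₁) v₁ (some u) hv hu h2
    have h0 := ih₁ v u hv hu h1
    refine h0.mono (by simp; omega) ?_
    rintro Q hQ ⟨x₁, hx₁, x₂, hx₂, x₃, hx₃, x₄, hx₄, w', hz, hcomp, hΦ⟩
    refine ⟨w', ?_, by rwa [hg] at hΦ⟩
    have hvQ := hQ.orientationDet_ne_zero hv
    have hlam : ∀ i, unitCoord ι Q v u i ≠ 0 := fun i => (hQ.unitCoord_pos hι hv hu i).ne'
    have hzt := hz true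
    have hzf := hz false
    rw [comp_extend_adjoinPoint _ _ _ _ _ hι] at hzt hzf
    obtain ⟨G₁, hG₁, e₁⟩ := exists_orientationDet_eq_dotProduct hι hvQ hlam hx₁ hx₂
    obtain ⟨G₂, hG₂, e₂⟩ := exists_orientationDet_eq_dotProduct hι hvQ hlam hx₃ hx₄
    let a : Fin 3 → ℝ := fun i => baryCoord (Q ∘ v) w' (ι i) / unitCoord ι Q v u i
    have ha : ∀ i, baryCoord (Q ∘ v) w' (ι i) = unitCoord ι Q v u i * a i := fun i =>
      (mul_div_cancel₀ _ (hlam i)).symm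
    have q₁ := (e₁ w' a ha).symm.trans hzt
    have q₂ := (e₂ w' a ha).symm.trans hzf
    obtain ⟨μ, hμ⟩ := exists_smul_of_dotProduct_eq_zero hc (frameForm_ne_zero_left hσ)
      ((mul_eq_zero.1 q₁).resolve_left hG₁) ((mul_eq_zero.1 q₂).resolve_left hG₂) hy
    refine ⟨μ, ?_, fun i => by rw [ha, hμ, Pi.smul_apply, smul_eq_mul]; ring⟩
    -- If `μ = 0`, all three coordinates of `w'` on the triangle vanish, whereas `w` has a nonzero
    -- one and its sign is preserved.
    rintro rfl
    obtain ⟨i, hi⟩ := Function.ne_iff.1 (frameForm_ne_zero_left hσ)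
    have hb : baryCoord (B ∘ v) w (ι i) ≠ 0 := by
      rw [baryCoord_framePoint hι hv hσ]
      exact div_ne_zero (mul_ne_zero (frameWeight_pos i).ne' hi) hσ
    have hs := hcomp.sign_baryCoord (v := some ∘ v₄) (x := none) (i := ι i) hv hb
    have h0 : baryCoord (Q ∘ v) w' (ι i) = 0 := by rw [ha, hμ]; simp
    change SignType.sign (baryCoord (Q ∘ v) w' (ι i)) = SignType.sign (baryCoord (B ∘ v) w (ι i))
      at hs
    rw [h0, sign_zero, eq_comm, sign_eq_zero_iff] at hs
    exact hb hs

end Construction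

/-! ### Dyadic points on a side of the triangle -/

section Approximation

theorem frameForm_vec (a b c : ℝ) : frameForm ![a, b, c] = 3 * a + 2 * b + 8 * c :=
  frameForm_eq _

theorem constructibleIn_vec_one_zero_zero : ConstructibleIn 0 ![1, 0, 0] := by
  convert ConstructibleIn.basis 0 using 1
  ext i; fin_cases i <;> rfl

theorem constructibleIn_vec_zero_one_zero : ConstructibleIn 0 ![0, 1, 0] := by
  convert ConstructibleIn.basis 1 using 1
  ext i; fin_cases i <;> rfl

theorem constructibleIn_vec_zero_zero_one : ConstructibleIn 0 ![0, 0, 1] := by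
  convert ConstructibleIn.basis 2 using 1
  ext i; fin_cases i <;> rfl

theorem constructibleIn_vec_one_one_one : ConstructibleIn 0 ![1, 1, 1] := by
  convert ConstructibleIn.unit using 1
  ext i; fin_cases i <;> rfl

open Matrix in
theorem cross_cross_eq_smul_of_forall {y₁ y₂ y₃ y₄ y : Fin 3 → ℝ} {c : ℝ}
    (h₀ : (crossProduct (crossProduct y₁ y₂) (crossProduct y₃ y₄)) 0 = c * y 0)
    (h₁ : (crossProduct (crossProduct y₁ y₂) (crossProduct y₃ y₄)) 1 = c * y 1)
    (h₂ : (crossProduct (crossProduct y₁ y₂) (crossProduct y₃ y₄)) 2 = c * y 2) :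
    crossProduct (crossProduct y₁ y₂) (crossProduct y₃ y₄) = c • y := by
  ext i
  fin_cases i
  exacts [h₀, h₁, h₂]

/-- The harmonic point used in the constructions of the two centers of projection. -/
theorem constructibleIn_harmonic : ConstructibleIn 3 ![0, 1, -1] := by
  have h₁ : ConstructibleIn 1 ![1, 1, 0] :=
    .meet 1 constructibleIn_vec_zero_zero_one constructibleIn_vec_one_one_one
      constructibleIn_vec_one_zero_zero constructibleIn_vec_zero_one_zero one_ne_zero
      (cross_cross_eq_smul_of_forall (by simp [cross_apply]) (by simp [cross_apply])
        (by simp [cross_apply])) (by norm_num [frameForm_vec])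
  have h₂ : ConstructibleIn 1 ![1, 0, 1] :=
    .meet (-1) constructibleIn_vec_zero_one_zero constructibleIn_vec_one_one_one
      constructibleIn_vec_one_zero_zero constructibleIn_vec_zero_zero_one (by norm_num)
      (cross_cross_eq_smul_of_forall (by simp [cross_apply]) (by simp [cross_apply])
        (by simp [cross_apply])) (by norm_num [frameForm_vec])
  exact .meet (-1) h₁ h₂ constructibleIn_vec_zero_one_zero constructibleIn_vec_zero_zero_one
    (by norm_num) (cross_cross_eq_smul_of_forall (by simp [cross_apply]) (by simp [cross_apply])
      (by simp [cross_apply])) (by norm_num [frameForm_vec])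

/-- The centres of projection `[±1 : -1 : 1]` lie on the line joining the first vertex to the
harmonic point; each is cut out by the line through the unit point and another vertex. -/
theorem constructibleIn_center_pos : ConstructibleIn 4 ![1, -1, 1] :=
  .meet 1 constructibleIn_vec_zero_one_zero constructibleIn_vec_one_one_one
    constructibleIn_vec_one_zero_zero constructibleIn_harmonic one_ne_zero
    (cross_cross_eq_smul_of_forall (by simp [cross_apply]) (by simp [cross_apply])
      (by simp [cross_apply])) (by norm_num [frameForm_vec])

theorem constructibleIn_center_neg : ConstructibleIn 4 ![-1, -1, 1] :=
  .meet (-1) constructibleIn_vec_zero_zero_one constructibleIn_vec_one_one_one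
    constructibleIn_vec_one_zero_zero constructibleIn_harmonic (by norm_num)
    (cross_cross_eq_smul_of_forall (by simp [cross_apply]) (by simp [cross_apply])
      (by simp [cross_apply])) (by norm_num [frameForm_vec])

/-- Two projections realize the map `t ↦ (t - s) / 2` on the first side of the triangle. -/
theorem ConstructibleIn.half {n : ℕ} {t s : ℝ} (h : ConstructibleIn n ![t, 1, 0])
    (hs : ConstructibleIn 4 ![s, -1, 1]) (ht : -1 ≤ t) (hts : 3 * ((t - s) / 2) + 2 ≠ 0) :
    ConstructibleIn (n + 6) ![(t - s) / 2, 1, 0] := by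
  -- First project from the third vertex onto the line through the first vertex and the unit point.
  -- Then project from `[s : -1 : 1]` back to the side: `(t, 1, 1) - (s, -1, 1) = (t - s, 2, 0)`.
  -- The given point is used only once, so the cost grows by a constant.
  have hg : ConstructibleIn (n + 1) ![t, 1, 1] := by
    have := ConstructibleIn.meet (y := ![t, 1, 1]) 1 constructibleIn_vec_zero_zero_one h
      constructibleIn_vec_one_zero_zero constructibleIn_vec_one_one_one one_ne_zero
      (cross_cross_eq_smul_of_forall (by simp [cross_apply]) (by simp [cross_apply])
        (by simp [cross_apply])) (by simp [frameForm_eq]; linarith)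
    simpa using this
  have := ConstructibleIn.meet (y := ![(t - s) / 2, 1, 0]) 2 hs hg
    constructibleIn_vec_one_zero_zero constructibleIn_vec_zero_one_zero two_ne_zero
    (cross_cross_eq_smul_of_forall (by simp [cross_apply]; ring)
      (by simp [cross_apply]; norm_num)
      (by simp [cross_apply])) (by simpa [frameForm_eq] using hts)
  convert this using 1
  omega

/-- On this side only `t = -2/3` lies at infinity, and it is not dyadic. -/
theorem three_mul_add_two_ne_zero_of_dyadic {t : ℝ} {k : ℕ} {n : ℤ} (h : t * 2 ^ k = n) :
    3 * t + 2 ≠ 0 := by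
  intro h0
  have h1 : 3 * n + 2 ^ (k + 1) = 0 := by
    have : (3 * n + 2 ^ (k + 1) : ℝ) = 0 := by rw [← h, pow_succ]; linear_combination 2 ^ k * h0
    exact_mod_cast this
  have h2 : (3 : ℤ) ∣ 2 ^ (k + 1) := ⟨-n, by linarith⟩
  have h3 := Int.prime_three.dvd_of_dvd_pow h2
  norm_num at h3

theorem exists_constructibleIn_near (k : ℕ) {r : ℝ} (hr : |r| ≤ 1) :
    ∃ t : ℝ, ConstructibleIn (6 * k) ![t, 1, 0] ∧ |t| ≤ 1 ∧ |t - r| ≤ (1 / 2) ^ k ∧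
      ∃ n : ℤ, t * 2 ^ k = n := by
  induction k generalizing r with
  | zero => exact ⟨0, constructibleIn_vec_zero_one_zero, by simp, by simpa using hr, 0, by simp⟩
  | succ k ih =>
    -- The map `t ↦ (t - s) / 2` halves errors, so approximating `r` reduces to approximating `2 * r
    -- + s`; the sign `s` opposite to that of `r` keeps this target in `[-1, 1]`.
    have step : ∀ s : ℝ, (s = 1 ∨ s = -1) → ConstructibleIn 4 ![s, -1, 1] → |2 * r + s| ≤ 1 →
        ∃ t : ℝ, ConstructibleIn (6 * (k + 1)) ![t, 1, 0] ∧ |t| ≤ 1 ∧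
          |t - r| ≤ (1 / 2) ^ (k + 1) ∧ ∃ n : ℤ, t * 2 ^ (k + 1) = n := by
      intro s hs hcs hrs
      obtain ⟨t, hc, ht, htr, n, hn⟩ := ih hrs
      have hn' : ∃ n' : ℤ, (t - s) / 2 * 2 ^ (k + 1) = n' := by
        rcases hs with rfl | rfl
        · exact ⟨n - 2 ^ k, by push_cast; rw [← hn, pow_succ]; ring⟩
        · exact ⟨n + 2 ^ k, by push_cast; rw [← hn, pow_succ]; ring⟩
      obtain ⟨n', hn'⟩ := hn'
      rw [abs_le] at ht
      refine ⟨(t - s) / 2, hc.half hcs ht.1 (three_mul_add_two_ne_zero_of_dyadic hn'), ?_, ?_,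
        n', hn'⟩
      · rw [abs_le]; rcases hs with rfl | rfl <;> constructor <;> linarith
      · rw [show (t - s) / 2 - r = (t - (2 * r + s)) * (1 / 2) by ring, abs_mul, pow_succ,
          abs_of_pos (by norm_num : (0 : ℝ) < 1 / 2)]
        gcongr
    rw [abs_le] at hr
    rcases le_total 0 r with h | h
    · exact step (-1) (Or.inr rfl) constructibleIn_center_neg
        (by rw [abs_le]; constructor <;> linarith)
    · exact step 1 (Or.inl rfl) constructibleIn_center_pos
        (by rw [abs_le]; constructor <;> linarith)

end Approximation

/-! ### Measuring the frame ratio of a point -/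

/-- The ratio of the first two frame coordinates of `x`. -/
noncomputable def frameRatio {d : ℕ} (ι : Fin 3 → Fin (d + 1))
    (p : Fin (d + 1) → EuclideanSpace ℝ (Fin d)) (lam : Fin 3 → ℝ) (x : EuclideanSpace ℝ (Fin d)) :
    ℝ :=
  (baryCoord p x (ι 0) / lam 0) / (baryCoord p x (ι 1) / lam 1)

section Ratios

variable {d : ℕ} {ι : Fin 3 → Fin (d + 1)} {p : Fin (d + 1) → EuclideanSpace ℝ (Fin d)}

theorem orientationDet_extend_eq_ratio (hι : Function.Injective ι) (hp : orientationDet p ≠ 0)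
    {lam : Fin 3 → ℝ} (hlam : ∀ i, lam i ≠ 0) {x y : EuclideanSpace ℝ (Fin d)} {μ t : ℝ}
    (hx : baryCoord p x (ι 1) ≠ 0)
    (hy : ∀ i, baryCoord p y (ι i) = μ * (lam i * ![t, 1, 0] i)) :
    orientationDet (Function.extend ι ![x, y, p (ι 2)] p) =
      orientationDet p * lam 0 * baryCoord p x (ι 1) * μ * (frameRatio ι p lam x - t) := by
  have h0 := hlam 0
  have h1 := hlam 1
  rw [orientationDet_extend hp hι, Matrix.det_fin_three, frameRatio]
  simp [hy, baryCoord_self hp, hι.eq_iff]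
  field_simp

/-- In the factorization of `orientationDet_extend_eq_ratio`, compatibility fixes the sign of every
factor except `frameRatio - t`, and it fixes the sign of the product. -/
theorem forces_sign_frameRatio_sub (hι : Function.Injective ι) {L : Type*} [Finite L]
    {B : PointConfig d L} (v : Fin (d + 1) → L) (u : L) (hv : orientationDet (B ∘ v) ≠ 0)
    (hu : B u = framePoint ι (B ∘ v) 1) (x : L) (hx : baryCoord (B ∘ v) (B x) (ι 1) ≠ 0)
    {n : ℕ} {t : ℝ} (ht : ConstructibleIn n ![t, 1, 0])
    (hr : frameRatio ι (B ∘ v) frameWeight (B x) ≠ t) :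
    Forces (4 * n) B fun Q =>
      SignType.sign (frameRatio ι (Q ∘ v) (unitCoord ι Q v u) (Q x) - t) =
        SignType.sign (frameRatio ι (B ∘ v) frameWeight (B x) - t) := by
  set w := framePoint ι (B ∘ v) ![t, 1, 0]
  have h := ht.forces hι v u hv hu (m := 0) (Φ := IsSignCompatible (adjoinPoint B w))
    (forces_of_compatible fun Q hQ => hQ)
  refine h.mono (by simp) ?_
  rintro Q hQ ⟨w', ⟨μ', hμ', hw'⟩, hcomp⟩
  obtain ⟨μ, hμ, hw⟩ := hasFrameCoord_framePoint hι hv ht.frameForm_ne_zero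
  have hvQ := hQ.orientationDet_ne_zero hv
  have hlam := hQ.unitCoord_pos hι hv hu
  have hxs := hQ.sign_baryCoord hv hx
  have hxQ : baryCoord (Q ∘ v) (Q x) (ι 1) ≠ 0 := by
    rw [← sign_ne_zero, hxs]; exact sign_ne_zero.2 hx
  let s : Fin (d + 1) → Option L :=
    Function.extend ι ![some x, none, some (v (ι 2))] (some ∘ v)
  have hs : ∀ (R : PointConfig d L) y, adjoinPoint R y ∘ s =
      Function.extend ι ![R x, y, (R ∘ v) (ι 2)] (R ∘ v) := fun R y => by
    ext1 j
    by_cases h : ∃ i, ι i = j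
    · obtain ⟨i, rfl⟩ := h
      simp only [s, Function.comp_apply, hι.extend_apply]
      fin_cases i <;> rfl
    · simp only [s, Function.comp_apply, Function.extend_apply' _ _ _ h]
      rfl
  have hD := orientationDet_extend_eq_ratio hι hv (fun i => (frameWeight_pos i).ne') hx hw
  have hDQ := orientationDet_extend_eq_ratio hι hvQ (fun i => (hlam i).ne') hxQ hw'
  rw [← hs] at hD hDQ
  have hne : orientationDet (adjoinPoint B w ∘ s) ≠ 0 := by
    rw [hD]
    exact mul_ne_zero (mul_ne_zero (mul_ne_zero (mul_ne_zero hv (frameWeight_pos 0).ne') hx) hμ)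
      (sub_ne_zero.2 hr)
  have hsign := hcomp s hne
  have hμs : SignType.sign μ' = SignType.sign μ := by
    have h1 : baryCoord (B ∘ v) w (ι 1) = μ * frameWeight 1 := by rw [hw]; simp
    have h2 : baryCoord (Q ∘ v) w' (ι 1) = μ' * unitCoord ι Q v u 1 := by rw [hw']; simp
    have h3 := hcomp.sign_baryCoord (v := some ∘ v) (x := none) (i := ι 1) hv (by
      change baryCoord (B ∘ v) w (ι 1) ≠ 0
      rw [h1]; exact mul_ne_zero hμ (frameWeight_pos 1).ne')
    change SignType.sign (baryCoord (Q ∘ v) w' (ι 1)) =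
      SignType.sign (baryCoord (B ∘ v) w (ι 1)) at h3
    rwa [h1, h2, sign_mul, sign_mul, sign_pos (hlam 1), sign_pos (frameWeight_pos 1), mul_one,
      mul_one] at h3
  rw [hD, hDQ] at hsign
  simp only [sign_mul, hμs, hxs, sign_pos (hlam 0), sign_pos (frameWeight_pos 0),
    hQ v hv] at hsign
  refine mul_left_cancel₀ ?_ hsign
  simp [hv, hx, hμ]

/-- The ratio of two frame coordinates can be prescribed up to an error exponentially small in
the number of new points. -/
theorem forces_abs_frameRatio_sub_lt (hι : Function.Injective ι) {L : Type*} [Finite L]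
    {B : PointConfig d L} (v : Fin (d + 1) → L) (u : L) (hv : orientationDet (B ∘ v) ≠ 0)
    (hu : B u = framePoint ι (B ∘ v) 1) (x : L) (hx : baryCoord (B ∘ v) (B x) (ι 1) ≠ 0)
    {r : ℝ} (hr : frameRatio ι (B ∘ v) frameWeight (B x) = r) (hr' : |r| ≤ 5 / 6) {k : ℕ}
    {h : ℝ} (hh : 0 < h) (hkh : (1 / 2 : ℝ) ^ k ≤ h) (hk : h ≤ 1 / 12) :
    Forces (48 * k) B fun Q =>
      |frameRatio ι (Q ∘ v) (unitCoord ι Q v u) (Q x) - r| < 3 * h := by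
  subst hr
  set r := frameRatio ι (B ∘ v) frameWeight (B x) with hrdef
  rw [abs_le] at hr'
  -- With error at most `h`, approximants of `r ± 3h/2` lie strictly on either side of `r` and
  -- within `5h/2` of it. Each costs `6 * k` intersections with four points apiece, hence `48 * k`
  -- in total.
  obtain ⟨t₁, hc₁, -, ht₁, -⟩ := exists_constructibleIn_near k (r := r + 3 / 2 * h)
    (by rw [abs_le]; constructor <;> linarith)
  obtain ⟨t₂, hc₂, -, ht₂, -⟩ := exists_constructibleIn_near k (r := r - 3 / 2 * h)
    (by rw [abs_le]; constructor <;> linarith)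
  replace ht₁ := abs_le.1 (ht₁.trans hkh)
  replace ht₂ := abs_le.1 (ht₂.trans hkh)
  have F₁ := forces_sign_frameRatio_sub hι v u hv hu x hx hc₁ (by linarith)
  have F₂ := forces_sign_frameRatio_sub hι v u hv hu x hx hc₂ (by linarith)
  refine (F₁.and F₂).mono (by omega) ?_
  rintro Q - ⟨h₁, h₂⟩
  rw [← hrdef, sign_neg (by linarith : r - t₁ < 0), sign_eq_neg_one_iff] at h₁
  rw [← hrdef, sign_pos (by linarith : 0 < r - t₂), sign_eq_one_iff] at h₂
  rw [abs_lt]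
  constructor <;> linarith

end Ratios

/-! ### Calibration by far points and ratios of barycentric coordinates -/

section Simplex

variable {d : ℕ}

theorem one_le_add_of_sum_eq_one {f : Fin (d + 1) → ℝ} (hf : ∑ i, f i = 1) {a b : Fin (d + 1)}
    (hab : a ≠ b) (h : ∀ c, c ≠ a → c ≠ b → f c ≤ 0) : 1 ≤ f a + f b := by
  rw [← Finset.sum_pair hab, ← hf,
    ← Finset.sum_sdiff (Finset.subset_univ ({a, b} : Finset (Fin (d + 1))))]
  refine add_le_of_nonpos_left (Finset.sum_nonpos fun c hc => ?_)
  simp only [Finset.mem_sdiff, Finset.mem_univ, true_and, Finset.mem_insert,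
    Finset.mem_singleton, not_or] at hc
  exact h c hc.1 hc.2

/-- Here `θ` is the unknown frame scale, with ideal value `2/3`. The hypotheses give `|θ * (q - s)|
≤ 3h + 4h * (5/4) = 8h`, and `θ ≥ 1/3`. -/
theorem abs_sub_le_of_abs_mul_sub_lt {θ q s h : ℝ} (hs₀ : 0 < s) (hs₁ : s ≤ 5 / 4) (hh : 0 < h)
    (hh' : h ≤ 1 / 12) (hlow : 2 / 3 - 4 * h < θ) (hup : θ < 2 / 3 + 4 * h)
    (hq : |θ * q - 2 / 3 * s| < 3 * h) : |q - s| ≤ 24 * h := by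
  rw [abs_lt] at hq
  have e₁ : (2 / 3 - θ) * s ≤ 4 * h * s := mul_le_mul_of_nonneg_right (by linarith) hs₀.le
  have e₂ : (θ - 2 / 3) * s ≤ 4 * h * s := mul_le_mul_of_nonneg_right (by linarith) hs₀.le
  have e₃ : h * s ≤ h * (5 / 4) := mul_le_mul_of_nonneg_left hs₁ hh.le
  have hθ : 1 / 3 ≤ θ := by linarith
  rw [abs_le]
  constructor
  · by_contra! hlt
    have := mul_le_mul_of_nonneg_right hθ (by linarith : 0 ≤ s - q)
    linarith
  · by_contra! hlt
    have := mul_le_mul_of_nonneg_right hθ (by linarith : 0 ≤ q - s)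
    linarith

end Simplex

/-- A point far away in the direction from the vertex `a` to the vertex `b`. -/
noncomputable def farPoint {d : ℕ} (p : Fin (d + 1) → EuclideanSpace ℝ (Fin d))
    (a b : Fin (d + 1)) (N : ℝ) : EuclideanSpace ℝ (Fin d) :=
  ∑ j, (-1 + (if j = a then 1 - N else 0) + (if j = b then N + d + 1 else 0)) • p j

section Pairs

variable {d : ℕ} {p : Fin (d + 1) → EuclideanSpace ℝ (Fin d)}

theorem baryCoord_farPoint (hp : orientationDet p ≠ 0) (a b j : Fin (d + 1)) (N : ℝ) :
    baryCoord p (farPoint p a b N) j =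
      -1 + (if j = a then 1 - N else 0) + (if j = b then N + d + 1 else 0) := by
  rw [farPoint, baryCoord_of_sum hp]
  simp [Finset.sum_add_distrib]
  ring

/-- In every configuration compatible with one that contains the far point, its coordinates at
the two vertices have positive sum. -/
theorem IsSignCompatible.farPoint_pos {L : Type*} {B Q : PointConfig d L}
    (hQ : IsSignCompatible B Q) {v : Fin (d + 1) → L} (hv : orientationDet (B ∘ v) ≠ 0) {f : L}
    {a b : Fin (d + 1)} (hab : a ≠ b) {N : ℝ} (hN : 0 < N) (hf : B f = farPoint (B ∘ v) a b N) :
    baryCoord (Q ∘ v) (Q f) a < 0 ∧ 0 < baryCoord (Q ∘ v) (Q f) b ∧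
      0 < baryCoord (Q ∘ v) (Q f) a + baryCoord (Q ∘ v) (Q f) b := by
  have hneg : ∀ c, c ≠ b → baryCoord (Q ∘ v) (Q f) c < 0 := fun c hc => by
    have h1 : baryCoord (B ∘ v) (B f) c < 0 := by
      rw [hf, baryCoord_farPoint hv]
      split_ifs <;> linarith
    rw [← sign_eq_neg_one_iff, hQ.sign_baryCoord hv h1.ne, sign_eq_neg_one_iff]
    exact h1
  have h := one_le_add_of_sum_eq_one (sum_baryCoord (hQ.orientationDet_ne_zero hv) (Q f)) hab
    fun c _ hc => (hneg c hc).le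
  have ha := hneg a hab
  exact ⟨ha, by linarith, by linarith⟩

/-- Ratios of barycentric coordinates can be prescribed up to an exponentially small error. -/
theorem forces_abs_baryCoord_div_sub_le (hd : 2 ≤ d) {L X : Type*} [Finite L] [Fintype X]
    {B : PointConfig d L} (v : Fin (d + 1) → L) (hv : orientationDet (B ∘ v) ≠ 0) (x : X → L)
    {a b : Fin (d + 1)} (hab : a ≠ b) (hxa : ∀ i, 0 < baryCoord (B ∘ v) (B (x i)) a)
    (hxb : ∀ i, 0 < baryCoord (B ∘ v) (B (x i)) b)
    (hx : ∀ i, baryCoord (B ∘ v) (B (x i)) a ≤ 5 / 4 * baryCoord (B ∘ v) (B (x i)) b)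
    {k : ℕ} {h : ℝ} (hh : 0 < h) (hkh : (1 / 2 : ℝ) ^ k ≤ h) (hk : h ≤ 1 / 12) :
    Forces (48 * k * (Fintype.card X + 2) + 3) B fun Q => ∀ i,
      |baryCoord (Q ∘ v) (Q (x i)) a / baryCoord (Q ∘ v) (Q (x i)) b -
        baryCoord (B ∘ v) (B (x i)) a / baryCoord (B ∘ v) (B (x i)) b| ≤ 24 * h := by
  obtain ⟨e, he⟩ : ∃ e : Fin (d + 1), e ∉ ({a, b} : Finset (Fin (d + 1))) := by
    by_contra! h
    have h1 : (Finset.univ : Finset (Fin (d + 1))).card ≤ ({a, b} : Finset (Fin (d + 1))).card :=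
      Finset.card_le_card fun c _ => h c
    have h2 := Finset.card_le_two (a := a) (b := b)
    simp at h1
    omega
  have hea : e ≠ a := fun h => he (by simp [h])
  have heb : e ≠ b := fun h => he (by simp [h])
  let ι : Fin 3 → Fin (d + 1) := ![a, b, e]
  have hι : Function.Injective ι := by
    intro i j hij
    fin_cases i <;> fin_cases j <;> simp_all [ι, eq_comm]
  have hd' : (2 : ℝ) ≤ d := by exact_mod_cast hd
  -- With this `N` the coordinate ratios `-N / (N + d)` and `-(N + d) / N` of the two far points are
  -- within `h / 4` of `-1`.
  obtain ⟨N, hN, hNh⟩ : ∃ N : ℝ, 0 < N ∧ N * h = 4 * d :=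
    ⟨4 * d / h, by positivity, div_mul_cancel₀ _ hh.ne'⟩
  let B₁ := adjoinPoint B (framePoint ι (B ∘ v) 1)
  let B₂ := adjoinPoint B₁ (farPoint (B ∘ v) a b N)
  let B₃ := adjoinPoint B₂ (farPoint (B ∘ v) b a N)
  let v₃ : Fin (d + 1) → Option (Option (Option L)) := fun j => some (some (some (v j)))
  let u : Option (Option (Option L)) := some (some none)
  let f₁ : Option (Option (Option L)) := some none
  let f₂ : Option (Option (Option L)) := none
  let x₃ : X → Option (Option (Option L)) := fun i => some (some (some (x i)))
  have hv₃ : orientationDet (B₃ ∘ v₃) ≠ 0 := hv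
  have hu : B₃ u = framePoint ι (B₃ ∘ v₃) 1 := rfl
  have hf₁ : B₃ f₁ = farPoint (B₃ ∘ v₃) a b N := rfl
  have hf₂ : B₃ f₂ = farPoint (B₃ ∘ v₃) b a N := rfl
  have hfa₁ : baryCoord (B₃ ∘ v₃) (B₃ f₁) a = -N := by
    rw [hf₁, baryCoord_farPoint hv₃]; simp [hab]; ring
  have hfb₁ : baryCoord (B₃ ∘ v₃) (B₃ f₁) b = N + d := by
    rw [hf₁, baryCoord_farPoint hv₃]; simp [hab.symm]
  have hfa₂ : baryCoord (B₃ ∘ v₃) (B₃ f₂) a = N + d := by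
    rw [hf₂, baryCoord_farPoint hv₃]; simp [hab]
  have hfb₂ : baryCoord (B₃ ∘ v₃) (B₃ f₂) b = -N := by
    rw [hf₂, baryCoord_farPoint hv₃]; simp [hab.symm]; ring
  have hratio : ∀ y, frameRatio ι (B₃ ∘ v₃) frameWeight y =
      2 / 3 * (baryCoord (B₃ ∘ v₃) y a / baryCoord (B₃ ∘ v₃) y b) := fun y => by
    simp only [frameRatio, ι, frameWeight]
    simp
    field_simp
  have hr₁ : frameRatio ι (B₃ ∘ v₃) frameWeight (B₃ f₁) = 2 / 3 * (-N / (N + d)) := by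
    rw [hratio, hfa₁, hfb₁]
  have hr₂ : frameRatio ι (B₃ ∘ v₃) frameWeight (B₃ f₂) = 2 / 3 * (-(1 + h / 4)) := by
    rw [hratio, hfa₂, hfb₂]
    congr 1
    rw [div_eq_iff (by linarith)]
    linear_combination -1 / 4 * hNh
  have hq₁ : -1 ≤ -N / (N + d) := by rw [le_div_iff₀ (by positivity)]; linarith
  have hq₂ : -N / (N + d) ≤ -(1 - h / 4) := by
    rw [div_le_iff₀ (by positivity)]
    nlinarith
  have F₁ := forces_abs_frameRatio_sub_lt hι v₃ u hv₃ hu f₁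
    (by change baryCoord (B₃ ∘ v₃) (B₃ f₁) b ≠ 0; rw [hfb₁]; positivity) hr₁
    (by rw [abs_le]; constructor <;> linarith) hh hkh hk
  have F₂ := forces_abs_frameRatio_sub_lt hι v₃ u hv₃ hu f₂
    (by change baryCoord (B₃ ∘ v₃) (B₃ f₂) b ≠ 0; rw [hfb₂]; linarith) hr₂
    (by rw [abs_le]; constructor <;> linarith) hh hkh hk
  have hs : ∀ i, 0 < baryCoord (B ∘ v) (B (x i)) a / baryCoord (B ∘ v) (B (x i)) b ∧
      baryCoord (B ∘ v) (B (x i)) a / baryCoord (B ∘ v) (B (x i)) b ≤ 5 / 4 := fun i =>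
    ⟨div_pos (hxa i) (hxb i), by rw [div_le_iff₀ (hxb i)]; exact hx i⟩
  have F₃ := forces_forall fun i => forces_abs_frameRatio_sub_lt hι v₃ u hv₃ hu (x₃ i)
    (hxb i).ne' (hratio (B₃ (x₃ i)))
    (by
      obtain ⟨h1, h2⟩ := hs i
      change |2 / 3 * (baryCoord (B ∘ v) (B (x i)) a / baryCoord (B ∘ v) (B (x i)) b)| ≤ 5 / 6
      rw [abs_le]; constructor <;> linarith) hh hkh hk
  have F := (((F₁.and (F₂.and F₃)).mono (Ψ := fun Q => IsSignCompatible B₃ Q ∧ _) le_rfl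
    fun Q hQ h => ⟨hQ, h⟩).of_adjoinPoint _).of_adjoinPoint _ |>.of_adjoinPoint _
  refine F.mono (by ring_nf; omega) ?_
  rintro Q hQ₀ ⟨u', f₁', f₂', hQ, h₁, h₂, h₃⟩ i
  set Q₃ := adjoinPoint (adjoinPoint (adjoinPoint Q u') f₁') f₂'
  have hlam := hQ.unitCoord_pos hι hv₃ hu
  set lam := unitCoord ι Q₃ v₃ u
  set θ := lam 1 / lam 0 with hθ
  have hθpos : 0 < θ := div_pos (hlam 1) (hlam 0)
  have hratioQ : ∀ y, frameRatio ι (Q₃ ∘ v₃) lam y =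
      θ * (baryCoord (Q₃ ∘ v₃) y a / baryCoord (Q₃ ∘ v₃) y b) := fun y => by
    have := (hlam 0).ne'
    have := (hlam 1).ne'
    simp only [frameRatio, hθ]
    change (baryCoord (Q₃ ∘ v₃) y a / lam 0) / (baryCoord (Q₃ ∘ v₃) y b / lam 1) = _
    field_simp
  obtain ⟨p₁, p₂, p₃⟩ := hQ.farPoint_pos hv₃ hab hN hf₁
  obtain ⟨q₁, q₂, q₃⟩ := hQ.farPoint_pos hv₃ hab.symm hN hf₂
  have h₃ := h₃ i
  rw [hratioQ] at h₁ h₂ h₃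
  -- In `Q` the coordinate ratio of the first far point exceeds `-1`, so its frame ratio exceeds
  -- `-θ`; the measurement puts that frame ratio within `3h` of a number at most `-2/3 * (1 - h /
  -- 4)`. The second far point bounds `θ` from above in the same way.
  have hlow : 2 / 3 - 4 * h < θ := by
    have : -1 < baryCoord (Q₃ ∘ v₃) (Q₃ f₁) a / baryCoord (Q₃ ∘ v₃) (Q₃ f₁) b := by
      rw [lt_div_iff₀ p₂]; linarith
    rw [abs_lt] at h₁
    nlinarith
  have hup : θ < 2 / 3 + 4 * h := by
    have : baryCoord (Q₃ ∘ v₃) (Q₃ f₂) a / baryCoord (Q₃ ∘ v₃) (Q₃ f₂) b < -1 := by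
      rw [div_lt_iff_of_neg q₁]; linarith
    rw [abs_lt] at h₂
    nlinarith
  obtain ⟨hs₀, hs₁⟩ := hs i
  change |θ * (baryCoord (Q ∘ v) (Q (x i)) a / baryCoord (Q ∘ v) (Q (x i)) b) -
    2 / 3 * (baryCoord (B ∘ v) (B (x i)) a / baryCoord (B ∘ v) (B (x i)) b)| < 3 * h at h₃
  set s := baryCoord (B ∘ v) (B (x i)) a / baryCoord (B ∘ v) (B (x i)) b
  set q := baryCoord (Q ∘ v) (Q (x i)) a / baryCoord (Q ∘ v) (Q (x i)) b
  exact abs_sub_le_of_abs_mul_sub_lt hs₀ hs₁ hh hk hlow hup h₃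

end Pairs

/-! ### From barycentric coordinates to affine maps -/

section Simplices

variable {d : ℕ}

/-- The simplex centered at the origin with vertices `M e₁, …, M e_d` and `-M (e₁ + ⋯ + e_d)`. -/
noncomputable def centeredSimplex (d : ℕ) (M : ℝ) (j : Fin (d + 1)) : EuclideanSpace ℝ (Fin d) :=
  WithLp.toLp 2 fun k => (Fin.snoc (fun l : Fin d => if k = l then M else 0) (-M) : Fin (d + 1) → ℝ) j

theorem orientationDet_centeredSimplex_ne_zero {M : ℝ} (hM : 0 < M) :
    orientationDet (centeredSimplex d M) ≠ 0 := by
  intro h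
  obtain ⟨z, hz, hz0⟩ := Matrix.exists_vecMul_eq_zero_iff.2 h
  have e : ∀ j, ∑ k : Fin d, z k.castSucc * centeredSimplex d M j k + z (Fin.last d) = 0 :=
    fun j => by
      have := congrFun hz0 j
      simpa [Matrix.vecMul, dotProduct, Fin.sum_univ_castSucc, homMatrix] using this
  have e₁ : ∀ l : Fin d, z l.castSucc * M + z (Fin.last d) = 0 := fun l => by
    simpa [centeredSimplex] using e l.castSucc
  have e₂ : -(∑ k : Fin d, z k.castSucc * M) + z (Fin.last d) = 0 := by
    simpa [centeredSimplex] using e (Fin.last d)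
  have e₃ : ∑ k : Fin d, z k.castSucc * M = -(d * z (Fin.last d)) := by
    rw [Finset.sum_congr rfl fun l _ => eq_neg_of_add_eq_zero_left (e₁ l)]
    simp
  have hlast : z (Fin.last d) = 0 := by
    rw [e₃] at e₂
    have : ((d : ℝ) + 1) * z (Fin.last d) = 0 := by linarith
    exact (mul_eq_zero.1 this).resolve_left (by positivity)
  refine hz (funext fun j => Fin.lastCases hlast (fun l => ?_) j)
  have := e₁ l
  rw [hlast, add_zero] at this
  exact (mul_eq_zero.1 this).resolve_right hM.ne'

theorem baryCoord_centeredSimplex {M : ℝ} (hM : 0 < M) (x : EuclideanSpace ℝ (Fin d))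
    (j : Fin (d + 1)) :
    baryCoord (centeredSimplex d M) x j = ((d : ℝ) + 1)⁻¹ +
      ((Fin.snoc (fun k : Fin d => x k) 0 : Fin (d + 1) → ℝ) j - ((d : ℝ) + 1)⁻¹ * ∑ k, x k) / M := by
  set c : Fin (d + 1) → ℝ := fun j => ((d : ℝ) + 1)⁻¹ +
    ((Fin.snoc (fun k : Fin d => x k) 0 : Fin (d + 1) → ℝ) j - ((d : ℝ) + 1)⁻¹ * ∑ k, x k) / M
  have hd : ((d : ℝ) + 1) ≠ 0 := by positivity
  have hc : ∑ j, c j = 1 := by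
    simp only [c, Finset.sum_add_distrib, ← Finset.sum_div, Finset.sum_sub_distrib]
    rw [Fin.sum_univ_castSucc (n := d) (f := (Fin.snoc (fun k : Fin d => x k) 0 : Fin (d + 1) → ℝ))]
    simp
    field_simp
    ring
  have hx : ∑ j, c j • centeredSimplex d M j = x := by
    ext k
    have : (∑ j, c j • centeredSimplex d M j) k = ∑ j, c j * centeredSimplex d M j k := by
      simp [Finset.sum_apply]
    rw [this, Fin.sum_univ_castSucc]
    simp [centeredSimplex, c]
    field_simp
    ring
  have := baryCoord_of_sum (orientationDet_centeredSimplex_ne_zero hM) c hc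
  rw [hx] at this
  rw [this]

/-- A finite configuration lies near the center of a large simplex. -/
theorem exists_simplex_baryCoord_near {X : Type*} [Finite X] (P : PointConfig d X) :
    ∃ v : Fin (d + 1) → EuclideanSpace ℝ (Fin d), orientationDet v ≠ 0 ∧
      (∀ i j, 0 < baryCoord v (P i) j) ∧
      ∀ i a b, baryCoord v (P i) a ≤ 5 / 4 * baryCoord v (P i) b := by
  obtain ⟨R, hR⟩ : ∃ R, ∀ i, ‖P i‖ ≤ R := by
    obtain ⟨R, hR⟩ := (Set.finite_range fun i => ‖P i‖).bddAbove
    exact ⟨R, fun i => hR ⟨i, rfl⟩⟩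
  have hR' : 0 < |R| + 1 := by positivity
  have hd : (0 : ℝ) < (d : ℝ) + 1 := by positivity
  -- At this size every barycentric coordinate is within ten percent of `1 / (d + 1)`, and `1.1 /
  -- 0.9 ≤ 5 / 4`.
  set M : ℝ := 20 * (d + 1) * (|R| + 1) with hMdef
  have hM : 0 < M := by positivity
  have key : ∀ i j, |baryCoord (centeredSimplex d M) (P i) j - ((d : ℝ) + 1)⁻¹| ≤
      1 / 10 * ((d : ℝ) + 1)⁻¹ := fun i j => by
    have hk : ∀ k, |P i k| ≤ |R| + 1 := fun k => by
      have h1 : |P i k| ≤ ‖P i‖ := PiLp.norm_apply_le (P i) k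
      have := hR i
      have := le_abs_self R
      linarith
    rw [baryCoord_centeredSimplex hM, add_sub_cancel_left, abs_div, abs_of_pos hM,
      div_le_iff₀ hM]
    have h1 : |(Fin.snoc (fun k : Fin d => P i k) 0 : Fin (d + 1) → ℝ) j| ≤ |R| + 1 := by
      refine Fin.lastCases ?_ (fun k => ?_) j
      · simpa using hR'.le
      · simpa using hk k
    have h2 : |((d : ℝ) + 1)⁻¹ * ∑ k, P i k| ≤ |R| + 1 := by
      rw [abs_mul, abs_of_pos (inv_pos.2 hd), inv_mul_le_iff₀ hd]
      calc |∑ k, P i k| ≤ ∑ k, |P i k| := Finset.abs_sum_le_sum_abs _ _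
        _ ≤ ∑ _k : Fin d, (|R| + 1) := Finset.sum_le_sum fun k _ => hk k
        _ = d * (|R| + 1) := by
          rw [Finset.sum_const, Finset.card_univ, Fintype.card_fin, nsmul_eq_mul]
        _ ≤ (d + 1) * (|R| + 1) := by gcongr; linarith
    calc _ ≤ _ := abs_sub _ _
      _ ≤ (|R| + 1) + (|R| + 1) := add_le_add h1 h2
      _ = 1 / 10 * ((d : ℝ) + 1)⁻¹ * M := by rw [hMdef]; field_simp; ring
  have hi : 0 < ((d : ℝ) + 1)⁻¹ := inv_pos.2 hd
  refine ⟨centeredSimplex d M, orientationDet_centeredSimplex_ne_zero hM, fun i j => ?_,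
    fun i a b => ?_⟩
  · have := abs_le.1 (key i j)
    linarith
  · have h1 := abs_le.1 (key i a)
    have h2 := abs_le.1 (key i b)
    linarith

/-- The affine equivalence that carries one nondegenerate simplex to another. -/
theorem exists_affineEquiv_of_simplices {p q : Fin (d + 1) → EuclideanSpace ℝ (Fin d)}
    (hp : orientationDet p ≠ 0) (hq : orientationDet q ≠ 0) :
    ∃ φ : EuclideanSpace ℝ (Fin d) ≃ᵃ[ℝ] EuclideanSpace ℝ (Fin d),
      ∀ x, φ x = ∑ j, baryCoord p x j • q j := by
  let e : EuclideanSpace ℝ (Fin d) →ₗ[ℝ] (Fin (d + 1) → ℝ) :=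
    { toFun := fun x => Fin.snoc (fun k : Fin d => x k) 0
      map_add' := fun x y => by
        ext j
        refine Fin.lastCases ?_ (fun k => ?_) j <;> simp
      map_smul' := fun c x => by
        ext j
        refine Fin.lastCases ?_ (fun k => ?_) j <;> simp }
  have he : ∀ w x, homCoord (w + x) = e w + homCoord x := fun w x => by
    ext j
    refine Fin.lastCases ?_ (fun k => ?_) j <;> simp [e]
  let φ : EuclideanSpace ℝ (Fin d) →ᵃ[ℝ] EuclideanSpace ℝ (Fin d) :=
    { toFun := fun x => ∑ j, baryCoord p x j • q j
      linear := (Fintype.linearCombination ℝ q) ∘ₗ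
        ((orientationDet p)⁻¹ • (homMatrix p).cramer) ∘ₗ e
      map_vadd' := fun x w => by
        simp only [vadd_eq_add, baryCoord_eq, he, map_add, smul_add, Pi.add_apply, add_smul,
          Finset.sum_add_distrib]
        rfl }
  have hinv : ∀ {p q : Fin (d + 1) → EuclideanSpace ℝ (Fin d)}, orientationDet p ≠ 0 →
      orientationDet q ≠ 0 → ∀ x,
      ∑ j, baryCoord q (∑ i, baryCoord p x i • q i) j • p j = x := fun hp hq x => by
    rw [baryCoord_of_sum hq _ (sum_baryCoord hp x), sum_baryCoord_smul hp]
  have hφ : Function.Bijective φ :=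
    Function.bijective_iff_has_inverse.2 ⟨fun x => ∑ j, baryCoord q x j • p j, hinv hp hq,
      hinv hq hp⟩
  exact ⟨AffineEquiv.ofBijective hφ, fun x => rfl⟩

theorem isDirect_of_simplices {p q : Fin (d + 1) → EuclideanSpace ℝ (Fin d)}
    (hp : orientationDet p ≠ 0)
    (hpq : SignType.sign (orientationDet p) = SignType.sign (orientationDet q))
    {φ : EuclideanSpace ℝ (Fin d) ≃ᵃ[ℝ] EuclideanSpace ℝ (Fin d)}
    (hφ : ∀ x, φ x = ∑ j, baryCoord p x j • q j) : IsDirect φ := by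
  have h1 : (fun j => φ.toAffineMap (p j)) = q := by
    funext j
    change φ (p j) = q j
    rw [hφ]
    simp [baryCoord_self hp]
  have h2 := orientationDet_map φ.toAffineMap p
  rw [h1] at h2
  rw [h2, sign_mul] at hpq
  have h3 : SignType.sign (LinearMap.det φ.toAffineMap.linear) = 1 := by
    refine mul_right_cancel₀ (sign_ne_zero.2 hp) ?_
    rw [one_mul]; exact hpq.symm
  exact sign_eq_one_iff.1 h3

/-- Since both families sum to one, `f a - g a = ∑ b, (f a * g b - g a * f b)`, and each term is a
difference of ratios times `f b * g b`. -/
theorem abs_sub_le_of_div_sub_div {f g : Fin (d + 1) → ℝ} (hf : ∀ i, 0 < f i) (hg : ∀ i, 0 < g i)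
    (hf1 : ∑ i, f i = 1) (hg1 : ∑ i, g i = 1) {η : ℝ}
    (h : ∀ a b, a ≠ b → |f a / f b - g a / g b| ≤ η) (hη : 0 ≤ η) (a : Fin (d + 1)) :
    |f a - g a| ≤ η := by
  have hle : ∀ b, f b ≤ 1 := fun b => by
    rw [← hf1]; exact Finset.single_le_sum (fun i _ => (hf i).le) (Finset.mem_univ b)
  have h1 : f a - g a = ∑ b, (f a * g b - g a * f b) := by
    rw [Finset.sum_sub_distrib, ← Finset.mul_sum, ← Finset.mul_sum, hf1, hg1]; ring
  have h2 : ∀ b, |f a * g b - g a * f b| ≤ η * g b := fun b => by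
    by_cases hab : a = b
    · subst hab
      rw [mul_comm, sub_self, abs_zero]
      exact mul_nonneg hη (hg a).le
    · have e : f a * g b - g a * f b = (f a / f b - g a / g b) * (f b * g b) := by
        have := (hf b).ne'
        have := (hg b).ne'
        field_simp
      rw [e, abs_mul, abs_of_pos (mul_pos (hf b) (hg b))]
      refine mul_le_mul (h a b hab) ?_ (mul_pos (hf b) (hg b)).le hη
      exact mul_le_of_le_one_left (hg b).le (hle b)
  rw [h1]
  calc _ ≤ ∑ b, |f a * g b - g a * f b| := Finset.abs_sum_le_sum_abs _ _
    _ ≤ ∑ b, η * g b := Finset.sum_le_sum fun b _ => h2 b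
    _ = η := by rw [← Finset.mul_sum, hg1, mul_one]

end Simplices

/-! ### Perturbation to a generic extension -/

section Genericity

variable {d : ℕ}

theorem mem_affineSpan_insert_exchange {x y : EuclideanSpace ℝ (Fin d)}
    {A : Set (EuclideanSpace ℝ (Fin d))} (h : y ∈ affineSpan ℝ (insert x A))
    (hy : y ∉ affineSpan ℝ A) : x ∈ affineSpan ℝ (insert y A) := by
  rcases A.eq_empty_or_nonempty with rfl | ⟨p₁, hp₁⟩
  · simp only [insert_empty_eq, AffineSubspace.mem_affineSpan_singleton] at h ⊢
    exact h.symm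
  · have hp₁ : p₁ ∈ affineSpan ℝ A := subset_affineSpan ℝ A hp₁
    rw [← affineSpan_insert_affineSpan] at h ⊢
    rw [AffineSubspace.mem_affineSpan_insert_iff hp₁] at h ⊢
    obtain ⟨r, p₀, hp₀, rfl⟩ := h
    have hr : r ≠ 0 := by
      rintro rfl
      simp [hp₀] at hy
    refine ⟨r⁻¹, AffineMap.lineMap p₁ p₀ (-r⁻¹), AffineMap.lineMap_mem _ hp₁ hp₀, ?_⟩
    simp only [AffineMap.lineMap_apply, vsub_eq_sub, vadd_eq_add, smul_sub, smul_add, smul_smul,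
      inv_mul_cancel₀ hr, one_smul, neg_smul]
    abel

/-- New points can be moved slightly so that none of them lies in a proper flat spanned by the
other points. -/
theorem exists_generic_near {X Y : Type*} [Finite X] [Finite Y] (B : PointConfig d X)
    (R : PointConfig d Y) {δ : ℝ} (hδ : 0 < δ) :
    ∃ R' : PointConfig d Y, (∀ y, dist (R' y) (R y) < δ) ∧
      ∀ (y : Y) (S : Set (X ⊕ Y)), Sum.inr y ∉ S →
        affineSpan ℝ (Sum.elim B R' '' S) ≠ ⊤ → R' y ∉ affineSpan ℝ (Sum.elim B R' '' S) := by
  classical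
  have := Fintype.ofFinite Y
  suffices H : ∀ T : Finset Y, ∃ R' : PointConfig d Y, (∀ y, dist (R' y) (R y) < δ) ∧
      ∀ y ∈ T, ∀ S : Set (X ⊕ Y), (∀ z, Sum.inr z ∈ S → z ∈ T) → Sum.inr y ∉ S →
        affineSpan ℝ (Sum.elim B R' '' S) ≠ ⊤ → R' y ∉ affineSpan ℝ (Sum.elim B R' '' S) by
    obtain ⟨R', h1, h2⟩ := H Finset.univ
    exact ⟨R', h1, fun y S => h2 y (Finset.mem_univ y) S fun z _ => Finset.mem_univ z⟩
  intro T
  induction T using Finset.induction_on with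
  | empty => exact ⟨R, fun y => by simpa using hδ, by simp⟩
  | insert z T hz ih =>
    obtain ⟨R', hR', hgen⟩ := ih
    obtain ⟨x, hxδ, hx⟩ : ∃ x, dist x (R z) < δ ∧ ∀ S : Set (X ⊕ Y),
        affineSpan ℝ (Sum.elim B R' '' S) ≠ ⊤ → x ∉ affineSpan ℝ (Sum.elim B R' '' S) := by
      -- Finitely many proper flats form a null set, so their complement meets every ball.
      have hae : ∀ᵐ x : EuclideanSpace ℝ (Fin d), ∀ S : Set (X ⊕ Y),
          affineSpan ℝ (Sum.elim B R' '' S) ≠ ⊤ →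
            x ∉ affineSpan ℝ (Sum.elim B R' '' S) := by
        refine MeasureTheory.ae_all_iff.2 fun S => ?_
        by_cases hS : affineSpan ℝ (Sum.elim B R' '' S) = ⊤
        · exact Eventually.of_forall fun x h => absurd hS h
        · filter_upwards [MeasureTheory.measure_eq_zero_iff_ae_notMem.1
            (MeasureTheory.Measure.addHaar_affineSubspace MeasureTheory.volume _ hS)] with x hx _
          exact hx
      obtain ⟨x, hx, hxb⟩ := (MeasureTheory.Measure.dense_of_ae hae).exists_mem_open
        Metric.isOpen_ball ⟨R z, Metric.mem_ball_self hδ⟩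
      exact ⟨x, hxb, hx⟩
    have himg : ∀ S : Set (X ⊕ Y), Sum.inr z ∉ S →
        Sum.elim B (Function.update R' z x) '' S = Sum.elim B R' '' S := fun S hS =>
      Set.image_congr fun o ho => by
        rcases o with o | o
        · rfl
        · have : o ≠ z := by rintro rfl; exact hS ho
          simp [this]
    refine ⟨Function.update R' z x, fun y => ?_, fun y hy S hST hyS hS => ?_⟩
    · by_cases h : y = z
      · subst h; simpa using hxδ
      · simpa [h] using hR' y
    by_cases hzS : Sum.inr z ∈ S
    · have hyz : y ≠ z := by rintro rfl; exact hyS hzS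
      have hyT : y ∈ T := (Finset.mem_insert.1 hy).resolve_left hyz
      set S₀ := S \ {Sum.inr z} with hS₀
      have hzS₀ : Sum.inr z ∉ S₀ := by simp [hS₀]
      have hins : Sum.elim B (Function.update R' z x) '' S =
          insert x (Sum.elim B R' '' S₀) := by
        have hSS₀ : S = insert (Sum.inr z) S₀ := (Set.insert_sdiff_self_of_mem hzS).symm
        conv_lhs => rw [hSS₀, Set.image_insert_eq, himg S₀ hzS₀]
        simp
      rw [Function.update_of_ne hyz]
      rw [hins] at hS ⊢
      intro hmem
      have hle : affineSpan ℝ (Sum.elim B R' '' S₀) ≤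
          affineSpan ℝ (insert x (Sum.elim B R' '' S₀)) :=
        affineSpan_mono ℝ (Set.subset_insert _ _)
      have hS₀T : ∀ w, Sum.inr w ∈ S₀ → w ∈ T := fun w hw =>
        (Finset.mem_insert.1 (hST w hw.1)).resolve_left (by rintro rfl; exact hzS₀ hw)
      have hnot := hgen y hyT S₀ hS₀T (fun h => hyS h.1) fun htop =>
        hS (top_le_iff.1 (htop ▸ hle))
      -- If the newly moved `x` put `y` into a proper flat, then by exchange `x` would lie in the
      -- span of `y` and `S₀`. That span is contained in the same proper flat, and `x` was chosen to
      -- avoid it.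
      have hex := mem_affineSpan_insert_exchange hmem hnot
      have himg' : Sum.elim B R' '' (insert (Sum.inr y) S₀) =
          insert (R' y) (Sum.elim B R' '' S₀) := by
        rw [Set.image_insert_eq]; rfl
      refine hx (insert (Sum.inr y) S₀) (fun htop => hS ?_) (by rwa [himg'])
      rw [himg'] at htop
      refine top_le_iff.1 (htop ▸ ?_)
      refine affineSpan_le.2 (Set.insert_subset hmem ?_)
      exact (subset_affineSpan ℝ _).trans hle
    · rw [himg S hzS] at hS ⊢
      by_cases hyz : y = z
      · subst hyz
        rw [Function.update_self]
        exact hx S hS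
      · rw [Function.update_of_ne hyz]
        refine hgen y ((Finset.mem_insert.1 hy).resolve_left hyz) S (fun w hw => ?_) hyS hS
        exact (Finset.mem_insert.1 (hST w hw)).resolve_left (by rintro rfl; exact hzS hw)

theorem IsHyperplane.ne_top {H : AffineSubspace ℝ (EuclideanSpace ℝ (Fin d))}
    (h : IsHyperplane H) : H ≠ ⊤ := by
  rintro rfl
  have := h.2
  rw [AffineSubspace.direction_top, finrank_top, finrank_euclideanSpace_fin] at this
  omega

/-- A property that can be forced can be forced by the chirotope of a generic extension. -/
theorem Forces.exists_generic_extension {X : Type*} [Finite X] {B : PointConfig d X} {n : ℕ}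
    {Φ : PointConfig d X → Prop} (h : Forces n B Φ) :
    ∃ (m : ℕ) (Phat : PointConfig d (X ⊕ Fin m)), m ≤ n ∧ IsGenericExtension Phat B ∧
      ∀ Q, IsRealizableOnTop (chirotope Phat) Q → Φ Q := by
  obtain ⟨Y, _, R, hY, hR⟩ := h
  let e := Fintype.equivFin Y
  have hclose : ∀ᶠ R' : PointConfig d (Fin (Fintype.card Y)) in 𝓝 (R ∘ e.symm),
      IsSignCompatible (Sum.elim B (R ∘ e.symm)) (Sum.elim B R') := by
    refine eventually_all.2 fun t => ?_
    by_cases ht : orientationDet (Sum.elim B (R ∘ e.symm) ∘ t) = 0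
    · exact Eventually.of_forall fun _ h => absurd ht h
    · have hcont : Continuous fun R' : PointConfig d (Fin (Fintype.card Y)) =>
          orientationDet (Sum.elim B R' ∘ t) := by
        refine continuous_orientationDet.comp (continuous_pi fun i => ?_)
        rcases hi : t i with y | y <;> simp [hi] <;> fun_prop
      rcases lt_or_gt_of_ne ht with h0 | h0
      · filter_upwards [(hcont.tendsto _).eventually_lt_const h0] with R' h' _
        rw [sign_neg h', sign_neg h0]
      · filter_upwards [(hcont.tendsto _).eventually_const_lt h0] with R' h' _
        rw [sign_pos h', sign_pos h0]
  obtain ⟨δ, hδ, hball⟩ := Metric.eventually_nhds_iff.1 hclose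
  obtain ⟨R', hR', hgen⟩ := exists_generic_near B (R ∘ e.symm) hδ
  refine ⟨Fintype.card Y, Sum.elim B R', hY, ⟨fun _ => rfl, fun y S hyS hS => ?_⟩, ?_⟩
  · exact hgen y S hyS hS.ne_top
  · rintro Q ⟨Qhat, hQ, hχ⟩
    have hcomp : IsSignCompatible (Sum.elim B (R ∘ e.symm)) Qhat := fun t ht => by
      rw [← hball ((dist_pi_lt_iff hδ).2 hR') t ht]
      exact congrFun hχ t
    have := hR (Qhat ∘ Sum.map id e) (by
      convert hcomp.comp (Sum.map id e) using 1
      ext1 o; rcases o with o | o <;> simp)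
    convert this using 1
    ext1 i
    exact (hQ i).symm

end Genericity

/-! ### Assembly and choice of constants -/

theorem forces_exists_direct_affineEquiv {d : ℕ} (hd : 2 ≤ d) {X : Type*} [Finite X]
    (P : PointConfig d X) :
    ∃ (A C : ℕ) (S : ℝ), 0 < S ∧ ∀ (k : ℕ) (h : ℝ), 0 < h → (1 / 2 : ℝ) ^ k ≤ h → h ≤ 1 / 12 →
      Forces (A * k + C) P fun Q =>
        ∃ φ : EuclideanSpace ℝ (Fin d) ≃ᵃ[ℝ] EuclideanSpace ℝ (Fin d),
          IsDirect φ ∧ ∀ i : X, ‖P i - φ (Q i)‖ ≤ S * h := by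
  have := Fintype.ofFinite X
  obtain ⟨v, hv, hpos, hratio⟩ := exists_simplex_baryCoord_near P
  refine ⟨(d + 1) * (d + 1) * (48 * (Fintype.card X + 2)), (d + 1) * (d + 1) * 3 + (d + 1),
    24 * (∑ j, ‖v j‖ + 1), by positivity, fun k h hh hkh hk => ?_⟩
  have F := forces_forall fun ab : Fin (d + 1) × Fin (d + 1) =>
    (show Forces (48 * k * (Fintype.card X + 2) + 3) (Sum.elim P v) (fun Q => ab.1 ≠ ab.2 → ∀ i : X,
      |baryCoord (Q ∘ Sum.inr) (Q (Sum.inl i)) ab.1 / baryCoord (Q ∘ Sum.inr) (Q (Sum.inl i)) ab.2 -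
        baryCoord v (P i) ab.1 / baryCoord v (P i) ab.2| ≤ 24 * h) by
      by_cases hab : ab.1 = ab.2
      · exact forces_of_compatible fun Q _ h => absurd hab h
      · exact (forces_abs_baryCoord_div_sub_le hd (B := Sum.elim P v) Sum.inr hv Sum.inl hab
          (fun i => hpos i _) (fun i => hpos i _) (fun i => hratio i _ _) hh hkh hk).mono le_rfl
          fun Q _ h _ => h)
  have F' := (F.mono (Ψ := fun Q => IsSignCompatible (Sum.elim P v) Q ∧ _) le_rfl
    fun Q hQ h => ⟨hQ, h⟩).of_sum_elim
  refine F'.mono (by simp; apply le_of_eq; ring) ?_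
  rintro Q - ⟨v', hcomp, hQ⟩
  have hv' : orientationDet v' ≠ 0 := hcomp.orientationDet_ne_zero (t := Sum.inr) hv
  obtain ⟨φ, hφ⟩ := exists_affineEquiv_of_simplices hv' hv
  refine ⟨φ, isDirect_of_simplices hv' (hcomp Sum.inr hv) hφ, fun i => ?_⟩
  have hpos' : ∀ j, 0 < baryCoord v' (Q i) j := fun j => by
    have := hcomp.sign_baryCoord (v := Sum.inr) (x := Sum.inl i) (i := j) hv (hpos i j).ne'
    rw [← sign_eq_one_iff]
    exact this.trans (sign_eq_one_iff.2 (hpos i j))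
  have hdiff : ∀ j, |baryCoord v' (Q i) j - baryCoord v (P i) j| ≤ 24 * h :=
    abs_sub_le_of_div_sub_div hpos' (hpos i) (sum_baryCoord hv' _) (sum_baryCoord hv _)
      (fun a b hab => hQ (a, b) hab i) (by positivity)
  have hsum : P i - φ (Q i) = ∑ j, (baryCoord v (P i) j - baryCoord v' (Q i) j) • v j := by
    simp only [sub_smul, Finset.sum_sub_distrib, sum_baryCoord_smul hv, hφ]
  rw [hsum]
  calc _ ≤ ∑ j, ‖(baryCoord v (P i) j - baryCoord v' (Q i) j) • v j‖ := norm_sum_le _ _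
    _ ≤ ∑ j, 24 * h * ‖v j‖ := Finset.sum_le_sum fun j _ => by
        rw [norm_smul, Real.norm_eq_abs, abs_sub_comm]
        exact mul_le_mul_of_nonneg_right (hdiff j) (norm_nonneg _)
    _ = 24 * h * ∑ j, ‖v j‖ := by rw [Finset.mul_sum]
    _ ≤ 24 * (∑ j, ‖v j‖ + 1) * h := by nlinarith

theorem theorem2 {d : ℕ} (hd : 2 ≤ d) {X : Type*} [Finite X] (P : PointConfig d X)
    (hP : IsFullDimensional P) :
    ∃ C τ : ℝ, 0 < τ ∧ ∀ ε : ℝ, 0 < ε → ε ≤ τ →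
      ∃ (m : ℕ) (Phat : PointConfig d (X ⊕ Fin m)),
        IsGenericExtension Phat P ∧
        (m : ℝ) ≤ C * Real.log (1 / ε) ∧
        ∀ Q : PointConfig d X, IsRealizableOnTop (chirotope Phat) Q →
          ∃ φ : EuclideanSpace ℝ (Fin d) ≃ᵃ[ℝ] EuclideanSpace ℝ (Fin d),
            IsDirect φ ∧ ∀ i : X, ‖P i - φ (Q i)‖ ≤ ε := by
  obtain ⟨A, C, S, hS, hF⟩ := forces_exists_direct_affineEquiv hd P
  have hlog2 : 0 < Real.log 2 := Real.log_pos one_lt_two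
  set c := |Real.log S|
  -- The bound `ε ≤ 1/2` gives `log (1/ε) ≥ log 2`, so additive constants are absorbed into `C`; the
  -- bound `ε ≤ S/12` makes the precision `h = ε / S` at most `1/12`.
  refine ⟨A / Real.log 2 + (A * (c / Real.log 2 + 1) + C) / Real.log 2, min (1 / 2) (S / 12),
    by positivity, fun ε hε hετ => ?_⟩
  have hε2 : ε ≤ 1 / 2 := hετ.trans (min_le_left _ _)
  have hεS : ε ≤ S / 12 := hετ.trans (min_le_right _ _)
  have hh : 0 < ε / S := by positivity
  let k := ⌈Real.log (S / ε) / Real.log 2⌉₊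
  have hk : (1 / 2 : ℝ) ^ k ≤ ε / S := by
    have h1 : Real.log (S / ε) ≤ k * Real.log 2 := by
      rw [← div_le_iff₀ hlog2]; exact Nat.le_ceil _
    have h2 : S / ε ≤ 2 ^ k := by
      rw [← Real.log_le_log_iff (by positivity) (by positivity), Real.log_pow]
      exact h1
    rw [div_pow, one_pow, div_le_div_iff₀ (by positivity) hS]
    rw [div_le_iff₀ hε] at h2
    linarith
  obtain ⟨m, Phat, hm, hgen, hQ⟩ := (hF k (ε / S) hh hk (by
    rw [div_le_iff₀ hS]; linarith)).exists_generic_extension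
  refine ⟨m, Phat, hgen, ?_, fun Q hQr => ?_⟩
  · set l := Real.log (1 / ε)
    have hl : Real.log 2 ≤ l := by
      refine Real.log_le_log two_pos ?_
      rw [le_div_iff₀ hε]; linarith
    have hkl : (k : ℝ) ≤ (l + c) / Real.log 2 + 1 := by
      have h1 : Real.log (S / ε) ≤ l + c := by
        rw [div_eq_mul_one_div, Real.log_mul hS.ne' (by positivity), add_comm]
        exact add_le_add_right (le_abs_self _) _
      have h0 : 0 ≤ (l + c) / Real.log 2 :=
        div_nonneg (add_nonneg (hlog2.le.trans hl) (abs_nonneg _)) hlog2.le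
      refine (Nat.ceil_le_ceil (div_le_div_of_nonneg_right h1 hlog2.le) |> Nat.cast_le.2).trans ?_
      exact (Nat.ceil_lt_add_one h0).le
    have hm' : (m : ℝ) ≤ A * k + C := by exact_mod_cast hm
    have h2 : A * (k : ℝ) ≤ A * ((l + c) / Real.log 2 + 1) :=
      mul_le_mul_of_nonneg_left hkl (Nat.cast_nonneg A)
    have h3 : A * (c / Real.log 2 + 1) + C ≤ (A * (c / Real.log 2 + 1) + C) / Real.log 2 * l := by
      rw [div_mul_eq_mul_div, le_div_iff₀ hlog2]
      exact mul_le_mul_of_nonneg_left hl (by positivity)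
    calc (m : ℝ) ≤ A * ((l + c) / Real.log 2 + 1) + C := by linarith
      _ = A / Real.log 2 * l + (A * (c / Real.log 2 + 1) + C) := by ring
      _ ≤ _ := by rw [add_mul]; linarith
  · obtain ⟨φ, hφ, hle⟩ := hQ Q hQr
    exact ⟨φ, hφ, fun i => (hle i).trans_eq (mul_div_cancel₀ _ hS.ne')⟩
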